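/- Let $(X,d)$ be a complete separable metric space, let $\mathfrak m$ be a non-zero Borel measure on $X$ that is finite on bounded sets, and let $1\le p<\infty$. (Under these assumptions $\mathfrak m$ is automatically a Radon measure.) Let $\mathcal L^p(X)$ be the set of $p$-integrable $\mathfrak m$-measurable functions $X\to\mathbb R$ and $L^p(X)$ its quotient by equality almost everywhere. **Curves.** A rectifiable curve is a continuous map $\gamma:[a,b]\to X$, $a<b$, of finite length $\ell(\gamma)$; for Borel $g:X\to[0,\infty]$ set $\int_\gamma g:=\int_0^{\ell(\gamma)}g(\gamma(s_\gamma(t)))\,dt$, where $\gamma\circ s_\gamma:[0,\ell(\gamma)]\to X$ is the arc-length reparametrization of $\gamma$. A Borel function $g:X\to[0,\infty]$ is an upper gradient of $u:X\to\mathbb R$, written $g\in \mathrm{UG}(u)$, if $|u(\gamma(b))-u(\gamma(a))|\le\int_\gamma g$ for every rectifiable curve $\gamma:[a,b]\to X$. Put $$F_{curve}(u):=\inf\{\|g\|_{L^p(X)}: g\in \mathrm{UG}(u)\}\qquad(u\in\mathcal L^p(X)).$$ **Chains.** For $\varepsilon>0$, an $\varepsilon$-chain is a finite sequence $c=(q_0,\dots,q_N)$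 in $X$ with $d(q_i,q_{i+1})\le\varepsilon$ for all $0\le i<N$, and $\int_c g:=\sum_{i=0}^{N-1}\frac{g(q_i)+g(q_{i+1})}2\,d(q_i,q_{i+1})$. Let $\mathrm{LUG}^{\varepsilon}(u)$ be the set of Lipschitz functions $g:X\to[0,\infty)$ such that $|u(q_N)-u(q_0)|\le\int_c g$ for every $\varepsilon$-chain $c=(q_0,\dots,q_N)$. For $u\in\mathcal L^p(X)$ put $$F_{C,Lip}(u):=\lim_{\varepsilon\to0^+}\inf\{\|g\|_{L^p(X)}: g\in \mathrm{LUG}^{\varepsilon}(u)\}\ \text{ if } u \text{ is Lipschitz},\qquad F_{C,Lip}(u):=+\infty\ \text{ otherwise.}$$ Infima over the empty set are $+\infty$. **Relaxation.** For $F\in\{F_{curve},F_{C,Lip}\}$ and $u\in L^p(X)$ let $$\widetilde F(u):=\inf\Big\{\liminf_{j\to\infty}F(u_j): u_j\in\mathcal L^p(X),\ u_j\to u \text{ in } L^p(X)\Big\},$$ let $H^{1,p}_F(X):=\{u\in L^p(X):\widetilde F(u)<\infty\}$ and $\|u\|_{H^{1,p}_F(X)}:=\big(\|u\|_{L^p(X)}^p+\widetilde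 F(u)^p\big)^{1/p}\in[0,\infty]$ for $u\in L^p(X)$. Write $H^{1,p}_{curve}(X)$ and $H^{1,p}_{C,Lip}(X)$ for the spaces obtained from $F_{curve}$ and $F_{C,Lip}$. **Theorem.** One has $H^{1,p}_{C,Lip}(X)=H^{1,p}_{curve}(X)$ as subsets of $L^p(X)$, and $$\|u\|_{H^{1,p}_{C,Lip}(X)}=\|u\|_{H^{1,p}_{curve}(X)}\qquad\text{for every } u\in L^p(X);$$ moreover $\widetilde F_{C,Lip}(u)=\widetilde F_{curve}(u)$ for every $u\in L^p(X)$. -/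

import Mathlib

open MeasureTheory Filter Topology Set
open scoped NNReal ENNReal

noncomputable section

namespace ChainSobolev

variable {X : Type*} [MetricSpace X]

/-! ### Curves and upper gradients -/

/-- Length of the curve `γ : [a,b] → X`. -/
def curveLength (γ : ℝ → X) (a b : ℝ) : ℝ≥0∞ := eVariationOn γ (Icc a b)

/-- `γ` restricted to `[a,b]` is a rectifiable curve: `a < b`, continuity and finite length. -/
structure IsRectifiableCurve (γ : ℝ → X) (a b : ℝ) : Prop where
  lt : a < b
  continuousOn : ContinuousOn γ (Icc a b)
  length_ne_top : curveLength γ a b ≠ ∞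

/-- The integral of `g` over the rectifiable curve `γ : [a,b] → X`, that is
`∫₀^ℓ g (γ (s t)) dt`, where `ℓ` is the length of `γ` and `γ ∘ s : [0,ℓ] → X` is its arc-length
reparametrization (Mathlib's `naturalParameterization`). -/
def curveIntegral (g : X → ℝ≥0∞) (γ : ℝ → X) (a b : ℝ) : ℝ≥0∞ :=
  ∫⁻ t in Icc 0 (curveLength γ a b).toReal, g (naturalParameterization γ (Icc a b) a t)

/-- The set of (Borel) upper gradients of `u`. -/
def UG [MeasurableSpace X] (u : X → ℝ) : Set (X → ℝ≥0∞) :=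
  {g | Measurable g ∧ ∀ (γ : ℝ → X) (a b : ℝ), IsRectifiableCurve γ a b →
    ENNReal.ofReal |u (γ b) - u (γ a)| ≤ curveIntegral g γ a b}

/-! ### Chains and chain upper gradients -/

/-- The points `q 0, …, q N` form an `ε`-chain. -/
def IsEpsChain (ε : ℝ) {N : ℕ} (q : Fin (N + 1) → X) : Prop :=
  ∀ i : Fin N, dist (q i.castSucc) (q i.succ) ≤ ε

/-- The integral of `g` over a chain. -/
def chainIntegral (g : X → ℝ≥0∞) {N : ℕ} (q : Fin (N + 1) → X) : ℝ≥0∞ :=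
  ∑ i : Fin N, (g (q i.castSucc) + g (q i.succ)) / 2 *
    ENNReal.ofReal (dist (q i.castSucc) (q i.succ))

/-- The set of (Borel) `ε`-upper gradients of `u`. -/
def chainUG [MeasurableSpace X] (ε : ℝ) (u : X → ℝ) : Set (X → ℝ≥0∞) :=
  {g | Measurable g ∧ ∀ (N : ℕ) (q : Fin (N + 1) → X), IsEpsChain ε q →
    ENNReal.ofReal |u (q (Fin.last N)) - u (q 0)| ≤ chainIntegral g q}

/-- `u` is Lipschitz, with some constant. -/
def IsLip {Y : Type*} [PseudoEMetricSpace Y] (u : X → Y) : Prop := ∃ K : ℝ≥0, LipschitzWith K u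

/-- The set of (finite valued) Lipschitz `ε`-upper gradients of `u`. -/
def chainLUG [MeasurableSpace X] (ε : ℝ) (u : X → ℝ) : Set (X → ℝ≥0∞) :=
  {g | g ∈ chainUG ε u ∧ ∃ f : X → ℝ≥0, IsLip f ∧ g = fun x => (f x : ℝ≥0∞)}

lemma chainLUG_anti [MeasurableSpace X] (u : X → ℝ) {ε ε' : ℝ} (h : ε' ≤ ε) :
    chainLUG ε u ⊆ chainLUG ε' u :=
  fun _ hg => ⟨⟨hg.1.1, fun N q hq => hg.1.2 N q fun i => (hq i).trans h⟩, hg.2⟩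

/-! ### Energies, relaxation and Sobolev spaces -/

/-- The energy `u ↦ inf {‖g‖_{L^p} : g upper gradient of u}`. -/
def energyCurve [MeasurableSpace X] (p : ℝ≥0∞) (μ : Measure X) (u : X → ℝ) : ℝ≥0∞ :=
  ⨅ g ∈ UG u, eLpNorm g p μ

/-- `inf {‖g‖_{L^p} : g Lipschitz ε-upper gradient of u}`. -/
def energyChainLipAt [MeasurableSpace X] (p : ℝ≥0∞) (μ : Measure X) (u : X → ℝ) (ε : ℝ) : ℝ≥0∞ :=
  ⨅ g ∈ chainLUG ε u, eLpNorm g p μ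

lemma energyChainLipAt_mono [MeasurableSpace X] (p : ℝ≥0∞) (μ : Measure X) (u : X → ℝ) :
    Monotone (energyChainLipAt p μ u) :=
  fun _ _ h => biInf_mono fun _ hg => chainLUG_anti u h hg

open Classical in
/-- The energy `lim_{ε → 0⁺} inf {‖g‖_{L^p} : g Lipschitz ε-upper gradient of u}` for Lipschitz
`u`, and `∞` for all other functions. The limit exists, see `tendsto_energyChainLipAt`. -/
def energyChainLip [MeasurableSpace X] (p : ℝ≥0∞) (μ : Measure X) (u : X → ℝ) : ℝ≥0∞ :=
  if IsLip u then limUnder (𝓝[>] (0 : ℝ)) (energyChainLipAt p μ u) else ∞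

lemma tendsto_energyChainLipAt [MeasurableSpace X] (p : ℝ≥0∞) (μ : Measure X) {u : X → ℝ}
    (hu : IsLip u) :
    Tendsto (energyChainLipAt p μ u) (𝓝[>] 0) (𝓝 (energyChainLip p μ u)) := by
  rw [energyChainLip, if_pos hu]
  exact tendsto_nhds_limUnder ⟨_, (energyChainLipAt_mono p μ u).tendsto_nhdsGT 0⟩

/-- The relaxation of `F` with respect to `L^p`-convergence, at `u`: the infimum of
`liminf_j F (v j)` over the sequences of `p`-integrable functions `v j` that converge to `u` in
`L^p`. It depends only on the almost-everywhere class of `u`. -/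
def relaxation [MeasurableSpace X] (p : ℝ≥0∞) (μ : Measure X) (F : (X → ℝ) → ℝ≥0∞)
    (u : X → ℝ) : ℝ≥0∞ :=
  ⨅ (v : ℕ → X → ℝ) (_ : ∀ j, MemLp (v j) p μ)
    (_ : Tendsto (fun j => eLpNorm (v j - u) p μ) atTop (𝓝 0)),
    liminf (fun j => F (v j)) atTop

/-- The space of all `u ∈ L^p` whose relaxed energy is finite. -/
def sobolevSpace [MeasurableSpace X] (p : ℝ≥0∞) (μ : Measure X) (F : (X → ℝ) → ℝ≥0∞) :
    Set (Lp ℝ p μ) :=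
  {u | relaxation p μ F u < ∞}

/-- `(‖u‖_{L^p}^p + (relaxed energy of u)^p)^{1/p}`, which is `∞` outside of `sobolevSpace`. -/
def sobolevNorm [MeasurableSpace X] (p : ℝ≥0∞) (μ : Measure X) (F : (X → ℝ) → ℝ≥0∞)
    (u : Lp ℝ p μ) : ℝ≥0∞ :=
  (eLpNorm u p μ ^ p.toReal + relaxation p μ F u ^ p.toReal) ^ (1 / p.toReal)

end ChainSobolev

end

namespace ChainSobolev

/-! ### Arc-length parametrization -/

section Curves

variable {X : Type*} [MetricSpace X]

/-! One inequality holds before relaxation. If `g` is a Lipschitz `ε`-upper gradient, subdividing a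
curve finely in arc length turns chain integrals into Riemann sums of `g`, so `g` is an upper
gradient (`chainLUG_subset_UG`).

For the other inequality it suffices to find, for `u ∈ L^p` with upper gradient `g`, a Lipschitz `w`
close to `u` in `L^p` having a Lipschitz `ε`-upper gradient of norm at most `‖g‖ + δ` for some `ε >
0`; a diagonal choice of `δ` then compares the relaxations. Truncation makes `u` bounded, and
cutoffs reduce to a finite measure.

In that case, enlarge `g` slightly in norm to a lower semicontinuous `G` that is bounded below by a
positive constant and large off compact sets (`exists_coercive_majorant`). Let `hₙ ↑ G` be its
Lipschitz envelopes and `v ≥ u` lower semicontinuous with almost the same integral. Let `Wₙ x` be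
the minimum of `M` and the infimum of `v (q 0) + ∫_c hₙ` over `1/(n+1)`-chains `c` ending at `x`.
Appending a point to a chain shows that `hₙ` is a chain upper gradient of `Wₙ`, and clearly `Wₙ ≤
v`.

The crux is `u ≤ sup Wₙ` (`le_iSup_chainMin`). Otherwise there are chains ending at some `x` with
costs below a constant `c < u x`. The lower bound on `G` bounds their lengths and coercivity keeps
them near compact sets, so they accumulate at a curve `γ` with `v (γ 0) + ∫ G ≤ c`
(`exists_curve_of_chains`), against `u x ≤ u (γ 0) + ∫_γ g`. Hence `Wₙ` is eventually close to `u`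
in `L¹`, and by boundedness in `L^p`. -/

lemma IsRectifiableCurve.boundedVariationOn {γ : ℝ → X} {a b : ℝ}
    (h : IsRectifiableCurve γ a b) : BoundedVariationOn γ (Icc a b) := h.length_ne_top

/-- The increment of arc length between `x` and `y` is the variation over the interval between them,
which vanishes as `y → x` from either side when `γ` is continuous. -/
lemma continuousOn_variationOnFromTo {γ : ℝ → X} {s : Set ℝ} {a : ℝ} (ha : a ∈ s)
    (hγ : ContinuousOn γ s) (hv : BoundedVariationOn γ s) :
    ContinuousOn (variationOnFromTo γ s a) s := by
  intro x hx
  have hl := hv.tendsto_eVariationOn_Icc_zero_left (x := x) ((hγ x hx).mono inter_subset_left)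
  have hr := hv.tendsto_eVariationOn_Icc_zero_right x ((hγ x hx).mono inter_subset_left)
  have hl' := (ENNReal.tendsto_toReal ENNReal.zero_ne_top).comp hl
  have hr' := (ENNReal.tendsto_toReal ENNReal.zero_ne_top).comp hr
  have hsum := hl'.add hr'
  simp only [ENNReal.toReal_zero, add_zero] at hsum
  rw [ContinuousWithinAt, tendsto_iff_dist_tendsto_zero]
  refine squeeze_zero' (Eventually.of_forall fun _ => dist_nonneg) ?_ hsum
  filter_upwards [self_mem_nhdsWithin] with y hy
  have hadd := variationOnFromTo.add hv.locallyBoundedVariationOn ha hx hy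
  have hd : dist (variationOnFromTo γ s a y) (variationOnFromTo γ s a x)
      = |variationOnFromTo γ s x y| := by
    rw [Real.dist_eq, ← hadd]; ring_nf
  rw [hd]
  have h1 : 0 ≤ (eVariationOn γ (s ∩ Icc y x)).toReal := ENNReal.toReal_nonneg
  have h2 : 0 ≤ (eVariationOn γ (s ∩ Icc x y)).toReal := ENNReal.toReal_nonneg
  simp only [Function.comp]
  rcases le_total x y with hxy | hxy
  · rw [variationOnFromTo.eq_of_le _ _ hxy, abs_of_nonneg h2]; linarith
  · rw [variationOnFromTo.eq_of_ge _ _ hxy, abs_neg, abs_of_nonneg h1]; linarith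

lemma variationOnFromTo_right (γ : ℝ → X) {a b : ℝ} (hab : a ≤ b) :
    variationOnFromTo γ (Icc a b) a b = (curveLength γ a b).toReal := by
  rw [variationOnFromTo.eq_of_le _ _ hab, inter_self, curveLength]

/-- Monotonicity and the intermediate value theorem. This makes the unit-speed property of
`naturalParameterization` available on the whole interval. -/
lemma IsRectifiableCurve.image_variationOnFromTo {γ : ℝ → X} {a b : ℝ}
    (h : IsRectifiableCurve γ a b) :
    variationOnFromTo γ (Icc a b) a '' Icc a b = Icc 0 (curveLength γ a b).toReal := by
  have ha : a ∈ Icc a b := left_mem_Icc.2 h.lt.le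
  have hb : b ∈ Icc a b := right_mem_Icc.2 h.lt.le
  have hv := h.boundedVariationOn
  have hmono := variationOnFromTo.monotoneOn hv.locallyBoundedVariationOn ha
  apply Subset.antisymm
  · rintro _ ⟨t, ht, rfl⟩
    refine ⟨variationOnFromTo.nonneg_of_le _ _ ht.1, ?_⟩
    rw [← variationOnFromTo_right γ h.lt.le]
    exact hmono ht hb ht.2
  · have := intermediate_value_Icc h.lt.le
      (continuousOn_variationOnFromTo ha h.continuousOn hv)
    rwa [variationOnFromTo.self, variationOnFromTo_right γ h.lt.le] at this

lemma naturalParameterization_variationOnFromTo {γ : ℝ → X} {s : Set ℝ} {a t : ℝ}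
    (hv : LocallyBoundedVariationOn γ s) (ha : a ∈ s) (ht : t ∈ s) :
    naturalParameterization γ s a (variationOnFromTo γ s a t) = γ t :=
  edist_eq_zero.1 (edist_naturalParameterization_eq_zero hv ha ht)

lemma IsRectifiableCurve.dist_naturalParameterization_le {γ : ℝ → X} {a b : ℝ}
    (h : IsRectifiableCurve γ a b) {s t : ℝ} (hs : s ∈ Icc 0 (curveLength γ a b).toReal)
    (ht : t ∈ Icc 0 (curveLength γ a b).toReal) (hst : s ≤ t) :
    dist (naturalParameterization γ (Icc a b) a s) (naturalParameterization γ (Icc a b) a t)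
      ≤ t - s := by
  have hu := has_unit_speed_naturalParameterization γ
    h.boundedVariationOn.locallyBoundedVariationOn (left_mem_Icc.2 h.lt.le)
  rw [h.image_variationOnFromTo] at hu
  have h1 := hu hs ht
  have h2 := eVariationOn.edist_le (naturalParameterization γ (Icc a b) a)
    (s := Icc 0 (curveLength γ a b).toReal ∩ Icc s t) ⟨hs, left_mem_Icc.2 hst⟩
    ⟨ht, right_mem_Icc.2 hst⟩
  rw [h1, NNReal.coe_one, one_mul, edist_dist] at h2
  exact (ENNReal.ofReal_le_ofReal_iff (by linarith)).1 h2

/-! ### Riemann sums -/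

/-- If the increments of `A` dominate the left Riemann sums of a Lipschitz function `f` up to a
quadratic error, then the total increment of `A` dominates the integral of `f`. -/
lemma integral_le_of_increments {A f : ℝ → ℝ} {L C ε : ℝ} (hL : 0 ≤ L) (hε : 0 < ε)
    (hf : ∀ s t, 0 ≤ s → s ≤ t → t ≤ L → |f t - f s| ≤ C * (t - s))
    (hA : ∀ s t, 0 ≤ s → s ≤ t → t ≤ L → t - s ≤ ε → (f s - C * (t - s)) * (t - s) ≤ A t - A s) :
    ∫ t in (0 : ℝ)..L, f t ≤ A L - A 0 := by
  have hcont : ContinuousOn f (Icc 0 L) := by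
    have : LipschitzOnWith C.toNNReal f (Icc 0 L) := by
      refine LipschitzOnWith.of_dist_le_mul fun x hx y hy => ?_
      have hC : C ≤ C.toNNReal := Real.le_coe_toNNReal C
      rcases le_total x y with hxy | hxy
      · rw [dist_comm, Real.dist_eq, dist_comm, Real.dist_eq, abs_of_nonneg (sub_nonneg.2 hxy)]
        exact (hf x y hx.1 hxy hy.2).trans
          (mul_le_mul_of_nonneg_right hC (sub_nonneg.2 hxy))
      · rw [Real.dist_eq, Real.dist_eq, abs_of_nonneg (sub_nonneg.2 hxy)]
        exact (hf y x hy.1 hxy hx.2).trans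
          (mul_le_mul_of_nonneg_right hC (sub_nonneg.2 hxy))
    exact this.continuousOn
  -- Use `n` equal steps: replacing `f` by its left value and then by the increment of `A` costs `C
  -- * (L / n) ^ 2` each time, so `2 * C * L ^ 2 / n` in total.
  have key : ∀ᶠ n : ℕ in atTop, ∫ t in (0 : ℝ)..L, f t ≤ A L - A 0 + 2 * C * L ^ 2 * (1 / n) := by
    obtain ⟨n₀, hn₀⟩ := exists_nat_gt (L / ε)
    filter_upwards [eventually_ge_atTop (max n₀ 1)] with n hn
    have hn0 : 0 < (n : ℝ) := by
      have := (le_max_right n₀ 1).trans hn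
      exact_mod_cast this
    have hLn : L / n ≤ ε := by
      rw [div_le_iff₀ hn0]
      have : (n₀ : ℝ) ≤ n := by exact_mod_cast (le_max_left n₀ 1).trans hn
      rw [div_lt_iff₀ hε] at hn₀
      nlinarith
    have hLn0 : 0 ≤ L / n := by positivity
    set x : ℕ → ℝ := fun i => i * (L / n) with hx
    have hx0 : x 0 = 0 := by simp [hx]
    have hxn : x n = L := by simp only [hx]; field_simp
    have hstep : ∀ i, x (i + 1) - x i = L / n := by intro i; simp only [hx]; push_cast; ring
    have hxle : ∀ i, x i ≤ x (i + 1) := fun i => by linarith [hstep i]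
    have hxmono : Monotone x := monotone_nat_of_le_succ hxle
    have hxi0 : ∀ i, 0 ≤ x i := fun i => by simp only [hx]; positivity
    have hsub : ∀ i < n, Icc (x i) (x (i + 1)) ⊆ Icc 0 L := fun i hi =>
      Icc_subset_Icc (hxi0 i) (hxn ▸ hxmono hi)
    have hint : ∀ i < n, IntervalIntegrable f volume (x i) (x (i + 1)) := fun i hi =>
      (hcont.mono (hsub i hi)).intervalIntegrable_of_Icc (hxle i)
    have h1 := intervalIntegral.sum_integral_adjacent_intervals hint
    have h2 : ∀ i ∈ Finset.range n, ∫ t in x i..x (i + 1), f t ≤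
        (A (x (i + 1)) - A (x i)) + 2 * C * (L / n) ^ 2 := by
      intro i hi
      have hi' := Finset.mem_range.1 hi
      have hxiL : x (i + 1) ≤ L := hxn ▸ hxmono hi'
      have hb : ∫ t in x i..x (i + 1), f t ≤ ∫ t in x i..x (i + 1), (f (x i) + C * (L / n)) := by
        refine intervalIntegral.integral_mono_on (hxle i) (hint i hi') (by simp) fun t ht => ?_
        have h3 := (abs_le.1 (hf (x i) t (hxi0 i) ht.1 (ht.2.trans hxiL))).2
        have h4 : C * (t - x i) ≤ C * (L / n) := by
          rcases le_or_gt 0 C with hC | hC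
          · exact mul_le_mul_of_nonneg_left (by linarith [ht.2, hstep i]) hC
          -- A negative `C` is harmless: the Lipschitz bound over a full step forces `0 ≤ C * (L /
          -- n)`.
          · have h5 := (abs_nonneg _).trans (hf (x i) (x (i + 1)) (hxi0 i) (hxle i) hxiL)
            rw [hstep] at h5
            have h6 := mul_nonpos_of_nonpos_of_nonneg hC.le (sub_nonneg.2 ht.1)
            linarith
        linarith
      rw [intervalIntegral.integral_const, hstep, smul_eq_mul] at hb
      have h3 := hA (x i) (x (i + 1)) (hxi0 i) (hxle i) hxiL ((hstep i).trans_le hLn)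
      rw [hstep] at h3
      nlinarith
    have h3 := Finset.sum_le_sum h2
    rw [h1, hx0, hxn, Finset.sum_add_distrib, Finset.sum_range_sub (fun i => A (x i)), hx0, hxn,
      Finset.sum_const, Finset.card_range, nsmul_eq_mul] at h3
    refine h3.trans (le_of_eq ?_)
    field_simp
  have hlim : Tendsto (fun n : ℕ => A L - A 0 + 2 * C * L ^ 2 * (1 / (n : ℝ))) atTop
      (𝓝 (A L - A 0 + 2 * C * L ^ 2 * 0)) :=
    tendsto_const_nhds.add (tendsto_const_nhds.mul tendsto_one_div_atTop_nhds_zero_nat)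
  rw [mul_zero, add_zero] at hlim
  exact ge_of_tendsto hlim key

/-! ### Lipschitz chain upper gradients are upper gradients -/

lemma chainUG_step [MeasurableSpace X] {ε : ℝ} {u : X → ℝ} {g : X → ℝ≥0∞}
    (hg : g ∈ chainUG ε u) {x y : X} (hxy : dist x y ≤ ε) :
    ENNReal.ofReal |u y - u x| ≤ (g x + g y) / 2 * ENNReal.ofReal (dist x y) := by
  have := hg.2 1 ![x, y] (by intro i; fin_cases i; simpa using hxy)
  simpa [chainIntegral] using this

/-- Since `f` is Lipschitz, the trapezoidal bound at a step of the arc-length curve is its left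
Riemann term up to a quadratic error. `integral_le_of_increments` with integrand `-f` applies to
both `u` and `-u` along the curve. -/
lemma chainLUG_subset_UG [MeasurableSpace X] {ε : ℝ} (hε : 0 < ε) (u : X → ℝ) :
    chainLUG ε u ⊆ UG u := by
  rintro g ⟨hg, f, ⟨K, hK⟩, rfl⟩
  refine ⟨hg.1, fun γ a b hγ => ?_⟩
  have hstep : ∀ x y : X, dist x y ≤ ε → |u y - u x| ≤ (f x + f y) / 2 * dist x y := by
    intro x y hxy
    have h := chainUG_step hg hxy
    have : ((f x : ℝ≥0∞) + f y) / 2 * ENNReal.ofReal (dist x y)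
        = ENNReal.ofReal (((f x : ℝ) + f y) / 2 * dist x y) := by
      rw [ENNReal.ofReal_mul (by positivity), ENNReal.ofReal_div_of_pos (by norm_num),
        ENNReal.ofReal_add (by positivity) (by positivity)]
      simp
    rw [this] at h
    exact (ENNReal.ofReal_le_ofReal_iff (by positivity)).1 h
  have hK' : ∀ x y, |(f x : ℝ) - f y| ≤ K * dist x y := fun x y => by
    have := hK.dist_le_mul x y
    rwa [NNReal.dist_eq] at this
  set l := (curveLength γ a b).toReal with hl
  set σ := naturalParameterization γ (Icc a b) a with hσ
  have hl0 : 0 ≤ l := ENNReal.toReal_nonneg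
  have hσd : ∀ s t, 0 ≤ s → s ≤ t → t ≤ l → dist (σ s) (σ t) ≤ t - s := fun s t hs hst ht =>
    hγ.dist_naturalParameterization_le ⟨hs, hst.trans ht⟩ ⟨hs.trans hst, ht⟩ hst
  have ha : a ∈ Icc a b := left_mem_Icc.2 hγ.lt.le
  have hb : b ∈ Icc a b := right_mem_Icc.2 hγ.lt.le
  have hv := hγ.boundedVariationOn.locallyBoundedVariationOn
  have hσ0 : σ 0 = γ a := by
    have := naturalParameterization_variationOnFromTo hv ha ha
    rwa [variationOnFromTo.self] at this
  have hσl : σ l = γ b := by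
    have := naturalParameterization_variationOnFromTo hv ha hb
    rwa [variationOnFromTo_right γ hγ.lt.le] at this
  have hinc : ∀ s t, 0 ≤ s → s ≤ t → t ≤ l → t - s ≤ ε →
      |u (σ t) - u (σ s)| ≤ (f (σ s) + K * (t - s)) * (t - s) := by
    intro s t hs hst ht hε'
    have hd := hσd s t hs hst ht
    have h1 := hstep (σ s) (σ t) (hd.trans hε')
    have h2 := (abs_le.1 (hK' (σ s) (σ t))).1
    have h3 : (K : ℝ) * dist (σ s) (σ t) ≤ K * (t - s) := mul_le_mul_of_nonneg_left hd K.2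
    have h5 : (0 : ℝ) ≤ K * (t - s) := mul_nonneg K.2 (sub_nonneg.2 hst)
    have h4 : ((f (σ s) : ℝ) + f (σ t)) / 2 ≤ f (σ s) + K * (t - s) := by linarith
    exact h1.trans (mul_le_mul h4 hd dist_nonneg (by positivity))
  have hlip : ∀ s t, 0 ≤ s → s ≤ t → t ≤ l →
      |(-(f (σ t) : ℝ)) - (-(f (σ s) : ℝ))| ≤ K * (t - s) := by
    intro s t hs hst ht
    rw [neg_sub_neg]
    exact (hK' _ _).trans (mul_le_mul_of_nonneg_left (hσd s t hs hst ht) K.2)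
  have hcont : ContinuousOn (fun t => (f (σ t) : ℝ)) (Icc 0 l) := by
    have : LipschitzOnWith 1 σ (Icc 0 l) := by
      refine LipschitzOnWith.of_dist_le_mul fun x hx y hy => ?_
      rw [NNReal.coe_one, one_mul]
      rcases le_total x y with hxy | hxy
      · rw [dist_comm x, Real.dist_eq, abs_of_nonneg (sub_nonneg.2 hxy)]
        exact hσd x y hx.1 hxy hy.2
      · rw [dist_comm, Real.dist_eq, abs_of_nonneg (sub_nonneg.2 hxy)]
        exact hσd y x hy.1 hxy hx.2
    exact (NNReal.continuous_coe.comp hK.continuous).comp_continuousOn this.continuousOn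
  have hmain : |u (γ b) - u (γ a)| ≤ ∫ t in (0 : ℝ)..l, (f (σ t) : ℝ) := by
    have hp := integral_le_of_increments (A := fun t => - u (σ t)) hl0 hε hlip
      fun s t hs hst ht hε' => by
        have := (abs_le.1 (hinc s t hs hst ht hε')).2
        linarith
    have hm := integral_le_of_increments (A := fun t => u (σ t)) hl0 hε hlip
      fun s t hs hst ht hε' => by
        have := (abs_le.1 (hinc s t hs hst ht hε')).1
        linarith
    rw [intervalIntegral.integral_neg, hσ0, hσl] at hp hm
    exact abs_le.2 ⟨by linarith, by linarith⟩
  refine (ENNReal.ofReal_le_ofReal hmain).trans (le_of_eq ?_)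
  rw [intervalIntegral.integral_of_le hl0, ← integral_Icc_eq_integral_Ioc,
    ofReal_integral_eq_lintegral_ofReal hcont.integrableOn_Icc
      (Eventually.of_forall fun t => (f (σ t)).2), curveIntegral]
  exact lintegral_congr fun t => by simp [hσ]

lemma energyCurve_le_energyChainLip [MeasurableSpace X] (p : ℝ≥0∞) (μ : Measure X) (u : X → ℝ) :
    energyCurve p μ u ≤ energyChainLip p μ u := by
  by_cases hu : IsLip u
  · refine ge_of_tendsto (tendsto_energyChainLipAt p μ hu) ?_
    filter_upwards [self_mem_nhdsWithin] with ε hε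
    exact le_iInf₂ fun g hg => iInf₂_le g (chainLUG_subset_UG hε u hg)
  · simp [energyChainLip, hu]

/-- Shrinking `ε` enlarges the class of gradients, so a gradient at a single scale bounds the limit.
-/
lemma energyChainLip_le_of_mem [MeasurableSpace X] (p : ℝ≥0∞) (μ : Measure X) {u : X → ℝ}
    (hu : IsLip u) {ε : ℝ} (hε : 0 < ε) {g : X → ℝ≥0∞} (hg : g ∈ chainLUG ε u) :
    energyChainLip p μ u ≤ eLpNorm g p μ := by
  refine le_of_tendsto (tendsto_energyChainLipAt p μ hu) ?_
  filter_upwards [Ioc_mem_nhdsGT hε] with ε' hε'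
  exact iInf₂_le g (chainLUG_anti u hε'.2 hg)

/-! ### Curves parametrized with speed at most one -/

lemma isRectifiableCurve_of_lipschitzOnWith {γ : ℝ → X} {L : ℝ} (hL : 0 < L)
    (hγ : LipschitzOnWith 1 γ (Icc 0 L)) : IsRectifiableCurve γ 0 L := by
  refine ⟨hL, hγ.continuousOn, ne_top_of_le_ne_top (b := ENNReal.ofReal (L - 0)) (by simp) ?_⟩
  have := hγ.comp_eVariationOn_le (g := id) (s := Icc 0 L) (mapsTo_id _)
  simpa [curveLength] using this

/-- Arc length `V` maps `[0,L]` onto `[0,ℓ]` and is 1-Lipschitz, so it does not increase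
one-dimensional Hausdorff measure: Lebesgue measure on `[0,ℓ]` is at most the image under `V` of
that on `[0,L]`. Needed because limits of chains have speed at most one, not exactly one. -/
lemma curveIntegral_le_lintegral {γ : ℝ → X} {L : ℝ} (hL : 0 < L)
    (hγ : LipschitzOnWith 1 γ (Icc 0 L)) (G : X → ℝ≥0∞) :
    curveIntegral G γ 0 L ≤ ∫⁻ t in Icc 0 L, G (γ t) := by
  have hr := isRectifiableCurve_of_lipschitzOnWith hL hγ
  have hv := hr.boundedVariationOn.locallyBoundedVariationOn
  have h0 : (0 : ℝ) ∈ Icc 0 L := left_mem_Icc.2 hL.le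
  set V := variationOnFromTo γ (Icc 0 L) 0 with hV
  set l := (curveLength γ 0 L).toReal with hl
  have hVlip : LipschitzOnWith 1 V (Icc 0 L) := by
    refine LipschitzOnWith.of_le_add_mul _ fun x hx y hy => ?_
    rw [NNReal.coe_one, one_mul]
    have hadd := variationOnFromTo.add hv h0 hy hx
    suffices variationOnFromTo γ (Icc 0 L) y x ≤ dist x y by simp only [hV]; linarith
    rcases le_total x y with hxy | hxy
    · exact (variationOnFromTo.nonpos_of_ge _ _ hxy).trans dist_nonneg
    · rw [variationOnFromTo.eq_of_le _ _ hxy, Real.dist_eq, abs_of_nonneg (sub_nonneg.2 hxy)]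
      refine ENNReal.toReal_le_of_le_ofReal (sub_nonneg.2 hxy) ?_
      have := (hγ.mono (inter_subset_left (t := Icc y x))).comp_eVariationOn_le
        (g := id) (s := Icc 0 L ∩ Icc y x) (mapsTo_id _)
      rwa [eVariationOn_id hy hx, ENNReal.coe_one, one_mul] at this
  have hVm : AEMeasurable V (volume.restrict (Icc 0 L)) :=
    hVlip.continuousOn.aemeasurable measurableSet_Icc
  have hle : volume.restrict (Icc 0 l) ≤ (volume.restrict (Icc 0 L)).map V := by
    refine Measure.le_iff.2 fun s hs => ?_
    rw [Measure.map_apply_of_aemeasurable hVm hs, Measure.restrict_apply hs]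
    have hsub : s ∩ Icc 0 l ⊆ V '' (V ⁻¹' s ∩ Icc 0 L) := by
      rintro x ⟨hxs, hx⟩
      rw [hl, ← hr.image_variationOnFromTo] at hx
      obtain ⟨t, ht, rfl⟩ := hx
      exact ⟨t, ⟨hxs, ht⟩, rfl⟩
    have h1 := (hVlip.mono (inter_subset_right (s := V ⁻¹' s))).hausdorffMeasure_image_le
      (d := 1) zero_le_one
    simp only [hausdorffMeasure_real, ENNReal.coe_one, ENNReal.one_rpow, one_mul] at h1
    exact (measure_mono hsub).trans (h1.trans (Measure.le_restrict_apply _ _))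
  calc curveIntegral G γ 0 L
      ≤ ∫⁻ t, G (naturalParameterization γ (Icc 0 L) 0 t) ∂((volume.restrict (Icc 0 L)).map V) :=
        lintegral_mono' hle le_rfl
    _ ≤ ∫⁻ t in Icc 0 L, G (naturalParameterization γ (Icc 0 L) 0 (V t)) := lintegral_map_le _ _
    _ = ∫⁻ t in Icc 0 L, G (γ t) := by
        refine setLIntegral_congr_fun measurableSet_Icc fun t ht => ?_
        simp only [hV, naturalParameterization_variationOnFromTo hv h0 ht]

end Curves

/-! ### Limits of chains -/

section Chains

variable {X : Type*} [MetricSpace X]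

/-- Length of the initial piece `q 0, …, q i` of a sequence of points. -/
noncomputable def chainLength (q : ℕ → X) (i : ℕ) : ℝ := ∑ j ∈ Finset.range i, dist (q j) (q (j + 1))

/-- Integral of `g` over the initial piece `q 0, …, q i` of a sequence of points. -/
noncomputable def chainCost (g : X → ℝ≥0) (q : ℕ → X) (i : ℕ) : ℝ :=
  ∑ j ∈ Finset.range i, ((g (q j) : ℝ) + g (q (j + 1))) / 2 * dist (q j) (q (j + 1))

lemma chainLength_mono (q : ℕ → X) : Monotone (chainLength q) :=
  monotone_nat_of_le_succ fun i => by
    rw [chainLength, chainLength, Finset.sum_range_succ]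
    linarith [dist_nonneg (x := q i) (y := q (i + 1))]

lemma chainLength_nonneg (q : ℕ → X) (i : ℕ) : 0 ≤ chainLength q i :=
  Finset.sum_nonneg fun _ _ => dist_nonneg

lemma chainCost_nonneg (g : X → ℝ≥0) (q : ℕ → X) (i : ℕ) : 0 ≤ chainCost g q i :=
  Finset.sum_nonneg fun _ _ => by positivity

lemma chainCost_mono (g : X → ℝ≥0) (q : ℕ → X) : Monotone (chainCost g q) :=
  monotone_nat_of_le_succ fun i => by
    rw [chainCost, chainCost, Finset.sum_range_succ]
    have : 0 ≤ ((g (q i) : ℝ) + g (q (i + 1))) / 2 * dist (q i) (q (i + 1)) := by positivity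
    linarith

lemma dist_le_chainLength_sub (q : ℕ → X) {i j : ℕ} (hij : i ≤ j) :
    dist (q i) (q j) ≤ chainLength q j - chainLength q i := by
  have := dist_le_Ico_sum_dist q hij
  rwa [Finset.sum_Ico_eq_sub _ hij] at this

/-- A function whose increments along the steps of a chain are controlled by `g` has its total
increment controlled by the integral of `g` over the chain. -/
lemma sub_le_chainCost_sub {g : X → ℝ≥0} {q : ℕ → X} {φ : X → ℝ} {i j : ℕ} (hij : i ≤ j)
    (hφ : ∀ k < j, φ (q (k + 1)) - φ (q k) ≤
      ((g (q k) : ℝ) + g (q (k + 1))) / 2 * dist (q k) (q (k + 1))) :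
    φ (q j) - φ (q i) ≤ chainCost g q j - chainCost g q i := by
  induction j, hij using Nat.le_induction with
  | base => simp
  | succ k hk ih =>
    have h1 := ih fun l hl => hφ l (hl.trans (Nat.lt_succ_self k))
    have h2 := hφ k (Nat.lt_succ_self k)
    rw [chainCost, Finset.sum_range_succ, ← chainCost]
    linarith

lemma mul_chainLength_sub_le {g : X → ℝ≥0} {q : ℕ → X} {c : ℝ} {i j : ℕ} (hij : i ≤ j)
    (hc : ∀ k, i ≤ k → k ≤ j → c ≤ g (q k)) :
    c * (chainLength q j - chainLength q i) ≤ chainCost g q j - chainCost g q i := by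
  induction j, hij using Nat.le_induction with
  | base => simp
  | succ k hk ih =>
    have h1 := ih fun l hl hl' => hc l hl (hl'.trans (Nat.le_succ k))
    have h2 : c ≤ ((g (q k) : ℝ) + g (q (k + 1))) / 2 := by
      linarith [hc k hk (Nat.le_succ k), hc (k + 1) (hk.trans (Nat.le_succ k)) le_rfl]
    have h3 := mul_le_mul_of_nonneg_right h2 (dist_nonneg (x := q k) (y := q (k + 1)))
    rw [chainCost, Finset.sum_range_succ, ← chainCost, chainLength, Finset.sum_range_succ,
      ← chainLength]
    linarith

/-- Discrete form of the hypothesis of `integral_le_of_increments`, stable under limits. Two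
functions occur because a fixed member of an increasing sequence is compared with the cost for a
later one. -/
lemma lipschitz_chainCost_sub_ge {g h : X → ℝ≥0} {K : ℝ≥0} (hg : LipschitzWith K g)
    (hgh : ∀ y, g y ≤ h y) (q : ℕ → X) {i j : ℕ} (hij : i ≤ j) :
    (g (q i) - K * (chainLength q j - chainLength q i)) * (chainLength q j - chainLength q i) ≤
      chainCost h q j - chainCost h q i := by
  refine mul_chainLength_sub_le hij fun k hik hkj => ?_
  have h1 := hg.dist_le_mul (q i) (q k)
  rw [NNReal.dist_eq] at h1
  have h2 : dist (q i) (q k) ≤ chainLength q j - chainLength q i :=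
    (dist_le_chainLength_sub q hik).trans (by linarith [chainLength_mono q hkj])
  have h3 := mul_le_mul_of_nonneg_left h2 K.2
  have h4 : (g (q k) : ℝ) ≤ h (q k) := hgh _
  have h5 := (abs_le.1 h1).2
  simp only [NNReal.val_eq_coe] at h3
  linarith

/-- Step parametrization of a chain by arc length. -/
lemma exists_chain_parametrization (q : ℕ → X) (N : ℕ) {ε : ℝ}
    (hstep : ∀ j < N, dist (q j) (q (j + 1)) ≤ ε) :
    ∃ i : ℝ → ℕ, Monotone i ∧ (∀ s, i s ≤ N) ∧ (∀ s, 0 ≤ s → chainLength q (i s) ≤ s) ∧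
      ∀ s, 0 ≤ s → min s (chainLength q N) ≤ chainLength q (i s) + max ε 0 := by
  classical
  -- Take the last vertex reached within length `s`. Unless it is `q N`, the next vertex overshoots
  -- `s`, so the lag is at most one step.
  refine ⟨fun s => Nat.findGreatest (fun i => chainLength q i ≤ s) N, ?_, ?_, ?_, ?_⟩
  · intro s t hst
    exact Nat.findGreatest_mono_left (fun i hi => hi.trans hst) N
  · exact fun s => Nat.findGreatest_le N
  · intro s hs
    exact Nat.findGreatest_spec (P := fun i => chainLength q i ≤ s) (Nat.zero_le N)
      (by simpa [chainLength] using hs)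
  · intro s hs
    rcases (Nat.findGreatest_le (P := fun i => chainLength q i ≤ s) N).eq_or_lt with h | h
    · simp only [h]
      exact (min_le_right _ _).trans (by linarith [le_max_right ε 0])
    · have h1 := Nat.findGreatest_is_greatest (P := fun i => chainLength q i ≤ s)
        (Nat.lt_succ_self _) h
      have h2 := hstep _ h
      rw [chainLength, Finset.sum_range_succ, ← chainLength] at h1
      exact (min_le_left _ _).trans (by linarith [le_max_left ε 0])

/-! ### Compactness along an ultrafilter and limit curves. -/

lemma exists_ultrafilter_tendsto_real {ι : Type*} (U : Ultrafilter ι) {f : ι → ℝ} {a b : ℝ}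
    (h : ∀ᶠ n in (U : Filter ι), f n ∈ Icc a b) : ∃ l, Tendsto f U (𝓝 l) := by
  obtain ⟨l, -, hl⟩ := isCompact_Icc.ultrafilter_le_nhds (U.map f) (le_principal_iff.2 h)
  exact ⟨l, hl⟩

/-- At each scale finitely many small balls cover the thickened compact set, and the ultrafilter
selects one of them; hence the image filter is Cauchy. -/
lemma exists_ultrafilter_tendsto [CompleteSpace X] {ι : Type*} (U : Ultrafilter ι) {f : ι → X}
    (h : ∀ ρ > 0, ∃ K : Set X, IsCompact K ∧ ∀ᶠ n in (U : Filter ι), f n ∈ Metric.thickening ρ K) :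
    ∃ z, Tendsto f U (𝓝 z) := by
  refine CompleteSpace.complete (f := (U : Filter ι).map f) (Metric.cauchy_iff.2
    ⟨inferInstance, fun ε hε => ?_⟩)
  obtain ⟨K, hK, hU⟩ := h (ε / 4) (by positivity)
  obtain ⟨t, htf, ht⟩ := Metric.totallyBounded_iff.1 hK.totallyBounded (ε / 4) (by positivity)
  have hsub : Metric.thickening (ε / 4) K ⊆ ⋃ y ∈ t, Metric.ball y (ε / 2) := by
    intro z hz
    obtain ⟨k, hk, hzk⟩ := Metric.mem_thickening_iff.1 hz
    obtain ⟨y, hy, hky⟩ := mem_iUnion₂.1 (ht hk)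
    refine mem_iUnion₂.2 ⟨y, hy, ?_⟩
    rw [Metric.mem_ball] at hky ⊢
    linarith [dist_triangle z k y]
  have hmem : (⋃ y ∈ t, Metric.ball y (ε / 2)) ∈ U.map f :=
    mem_of_superset (Filter.mem_map.2 hU) hsub
  obtain ⟨y, -, hy⟩ := (Ultrafilter.finite_biUnion_mem_iff htf).1 hmem
  refine ⟨Metric.ball y (ε / 2), hy, fun a ha b hb => ?_⟩
  rw [Metric.mem_ball] at ha hb
  linarith [dist_triangle_right a b y]

/-- If `g` is large away from `K`, then a chain along which the integral of `g` is small stays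
close to `K` and to its endpoint. -/
lemma mem_thickening_of_chainCost_le {g : X → ℝ≥0} {q : ℕ → X} {N : ℕ} {K : Set X} {m ρ c : ℝ}
    (hm : 0 ≤ m) (hρ : 0 < ρ) (hg : ∀ y, y ∉ Metric.thickening ρ K → m ≤ g y)
    (hcost : chainCost g q N ≤ c) (hc : 2 * c < m * ρ) {i : ℕ} (hi : i ≤ N) :
    q i ∈ Metric.thickening (2 * ρ) (insert (q N) K) := by
  by_contra hcon
  have hnot : ∀ y, dist y (q i) < ρ → m ≤ g y := by
    intro y hy
    refine hg y fun hyK => hcon ?_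
    obtain ⟨k, hk, hyk⟩ := Metric.mem_thickening_iff.1 hyK
    refine Metric.mem_thickening_iff.2 ⟨k, mem_insert_of_mem _ hk, ?_⟩
    linarith [dist_triangle_left (q i) k y]
  have hlip : ∀ y z, min (dist z (q i)) ρ - min (dist y (q i)) ρ ≤ dist y z := by
    intro y z
    have := dist_triangle_left z (q i) y
    rcases le_total (dist y (q i)) ρ with h | h
    · rw [min_eq_left h]; linarith [min_le_left (dist z (q i)) ρ]
    · rw [min_eq_right h]; linarith [min_le_right (dist z (q i)) ρ, dist_nonneg (x := y) (y := z)]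
  -- If `q i` were far from `K`, this potential would be controlled by `g` along the chain: it is
  -- constant outside the `ρ`-ball of `q i`, and a step meeting the ball has `g ≥ m` at one endpoint
  -- at least, whence the factor `1/2`. Reaching distance `ρ` would cost `m * ρ / 2 > c`.
  have hφ := sub_le_chainCost_sub (g := g) (q := q) (φ := fun y => m / 2 * min (dist y (q i)) ρ) hi
    fun k _ => by
      have h1 := hlip (q k) (q (k + 1))
      have h0 : 0 ≤ ((g (q k) : ℝ) + g (q (k + 1))) / 2 * dist (q k) (q (k + 1)) := by positivity
      have hgk : (0 : ℝ) ≤ g (q k) := (g (q k)).2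
      have hgk' : (0 : ℝ) ≤ g (q (k + 1)) := (g (q (k + 1))).2
      have hmain : m ≤ (g (q k) : ℝ) + g (q (k + 1)) →
          m / 2 * min (dist (q (k + 1)) (q i)) ρ - m / 2 * min (dist (q k) (q i)) ρ ≤
            ((g (q k) : ℝ) + g (q (k + 1))) / 2 * dist (q k) (q (k + 1)) := fun h => by
        rw [← mul_sub]
        exact (mul_le_mul_of_nonneg_left h1 (by positivity)).trans
          (mul_le_mul_of_nonneg_right (by linarith) dist_nonneg)
      rcases lt_or_ge (dist (q k) (q i)) ρ with h | h
      · exact hmain (by linarith [hnot _ h])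
      rcases lt_or_ge (dist (q (k + 1)) (q i)) ρ with h' | h'
      · exact hmain (by linarith [hnot _ h'])
      rw [min_eq_right h, min_eq_right h', sub_self]
      exact h0
  simp only [dist_self, min_eq_left hρ.le, mul_zero, sub_zero] at hφ
  have h1 := chainCost_nonneg g q i
  have h2 : dist (q N) (q i) < ρ := by
    by_contra hge
    rw [min_eq_right (not_lt.1 hge)] at hφ
    linarith
  refine hcon (Metric.mem_thickening_iff.2 ⟨q N, mem_insert _ _, ?_⟩)
  rw [dist_comm]
  linarith

/-- Chains of vanishing step size, along which the integrals of an increasing sequence of coercive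
Lipschitz functions are bounded, accumulate at a curve. -/
lemma exists_curve_of_chains [CompleteSpace X] {g : ℕ → X → ℝ≥0}
    (hlip : ∀ n, ∃ K, LipschitzWith K (g n)) (hmono : Monotone g) {η : ℝ} (hη : 0 < η)
    (hgη : ∀ᶠ n in atTop, ∀ y, η ≤ g n y)
    (hcoer : ∀ m ρ : ℝ, 0 < ρ → ∃ K : Set X, IsCompact K ∧
      ∀ᶠ n in atTop, ∀ y, y ∉ Metric.thickening ρ K → m ≤ g n y)
    {v : X → ℝ≥0∞} (hv : LowerSemicontinuous v) {x : X} {c : ℝ≥0∞} (hc : c ≠ ∞)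
    {ε : ℕ → ℝ} (hε : Tendsto ε atTop (𝓝 0)) {q : ℕ → ℕ → X} {N : ℕ → ℕ}
    (hstep : ∀ n, ∀ j < N n, dist (q n j) (q n (j + 1)) ≤ ε n) (hend : ∀ n, q n (N n) = x)
    (hcost : ∀ n, v (q n 0) + ENNReal.ofReal (chainCost (g n) (q n) (N n)) ≤ c) :
    ∃ (L : ℝ) (γ : ℝ → X), 0 ≤ L ∧ LipschitzOnWith 1 γ (Icc 0 L) ∧ γ L = x ∧
      v (γ 0) + ∫⁻ t in Icc 0 L, ⨆ n, (g n (γ t) : ℝ≥0∞) ≤ c := by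
  -- A single ultrafilter provides the limits at all parameters `s` at once, with no extraction of
  -- subsequences.
  let U : Ultrafilter ℕ := hyperfilter ℕ
  have hU : (U : Filter ℕ) ≤ atTop := Nat.hyperfilter_le_atTop
  have hcr : ∀ n, chainCost (g n) (q n) (N n) ≤ c.toReal := fun n =>
    (ENNReal.ofReal_le_iff_le_toReal hc).1 (le_add_self.trans (hcost n))
  have hcr0 : 0 ≤ c.toReal := ENNReal.toReal_nonneg
  have hlen : ∀ᶠ n in atTop, chainLength (q n) (N n) ≤ c.toReal / η := by
    filter_upwards [hgη] with n hn
    have := mul_chainLength_sub_le (g := g n) (q := q n) (Nat.zero_le (N n)) fun k _ _ => hn (q n k)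
    simp only [chainLength, chainCost, Finset.range_zero, Finset.sum_empty, sub_zero] at this
    rw [le_div_iff₀ hη, mul_comm]
    exact this.trans (hcr n)
  choose i himono hiN hile hige using fun n => exists_chain_parametrization (q n) (N n) (hstep n)
  have hpt : ∀ j : ℕ → ℕ, (∀ n, j n ≤ N n) → ∃ z, Tendsto (fun n => q n (j n)) U (𝓝 z) := by
    intro j hj
    refine exists_ultrafilter_tendsto U fun ρ hρ => ?_
    -- Chosen so that `2 * c < m * (ρ / 2)`; the radius is halved because
    -- `mem_thickening_of_chainCost_le` doubles it.
    set m := (2 * c.toReal + 1) / (ρ / 2) with hm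
    obtain ⟨K, hK, hKn⟩ := hcoer m (ρ / 2) (by positivity)
    refine ⟨insert x K, hK.insert x, hU ?_⟩
    filter_upwards [hKn] with n hn
    have h2 : 2 * c.toReal < m * (ρ / 2) := by
      rw [hm, div_mul_cancel₀ _ (by positivity)]; linarith
    have := mem_thickening_of_chainCost_le (by positivity) (by positivity) hn (hcr n) h2 (hj n)
    rwa [hend n, mul_div_cancel₀ _ two_ne_zero] at this
  choose γ hγ using fun s : ℝ => hpt (fun n => i n s) fun n => hiN n s
  obtain ⟨L, hL⟩ := exists_ultrafilter_tendsto_real U (f := fun n => chainLength (q n) (N n))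
    (hU (hlen.mono fun n hn => ⟨chainLength_nonneg _ _, hn⟩))
  choose A hA using fun s : ℝ => exists_ultrafilter_tendsto_real U
    (f := fun n => chainCost (g n) (q n) (i n s)) (a := 0) (b := c.toReal)
    (Eventually.of_forall fun n => ⟨chainCost_nonneg _ _ _,
      (chainCost_mono _ _ (hiN n s)).trans (hcr n)⟩)
  obtain ⟨I, hI⟩ := exists_ultrafilter_tendsto_real U
    (f := fun n => chainCost (g n) (q n) (N n)) (a := 0) (b := c.toReal)
    (Eventually.of_forall fun n => ⟨chainCost_nonneg _ _ _, hcr n⟩)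
  have hL0 : 0 ≤ L := ge_of_tendsto hL (Eventually.of_forall fun n => chainLength_nonneg _ _)
  have hεU : Tendsto (fun n => max (ε n) 0) U (𝓝 0) := by
    have := (hε.max (tendsto_const_nhds (x := (0 : ℝ)))).mono_left hU
    rwa [max_self] at this
  have hlenlim : ∀ s, 0 ≤ s → s ≤ L →
      Tendsto (fun n => chainLength (q n) (i n s)) U (𝓝 s) := by
    intro s hs hsL
    have h1 : Tendsto (fun n => min s (chainLength (q n) (N n)) - max (ε n) 0) U (𝓝 s) := by
      have := (tendsto_const_nhds (x := s)).min hL |>.sub hεU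
      rwa [min_eq_left hsL, sub_zero] at this
    exact tendsto_of_tendsto_of_tendsto_of_le_of_le h1 tendsto_const_nhds
      (fun n => by have := hige n s hs; simp only; linarith) (fun n => hile n s hs)
  have hdist : ∀ s t, 0 ≤ s → s ≤ t → t ≤ L → dist (γ s) (γ t) ≤ t - s := fun s t hs hst ht =>
    le_of_tendsto_of_tendsto ((hγ s).dist (hγ t))
      ((hlenlim t (hs.trans hst) ht).sub (hlenlim s hs (hst.trans ht)))
      (Eventually.of_forall fun n => dist_le_chainLength_sub (q n) (himono n hst))
  have hγlip : LipschitzOnWith 1 γ (Icc 0 L) := by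
    refine LipschitzOnWith.of_dist_le_mul fun s hs t ht => ?_
    rw [NNReal.coe_one, one_mul]
    rcases le_total s t with hst | hst
    · rw [dist_comm s, Real.dist_eq, abs_of_nonneg (sub_nonneg.2 hst)]
      exact hdist s t hs.1 hst ht.2
    · rw [dist_comm, Real.dist_eq, abs_of_nonneg (sub_nonneg.2 hst)]
      exact hdist t s ht.1 hst hs.2
  -- The vertex with index `i n L` need not be the last one, but the length remaining after it tends
  -- to `0`.
  have hγL : γ L = x := by
    have h0 := hL.sub (hlenlim L hL0 le_rfl)
    rw [sub_self] at h0
    refine dist_le_zero.1 (le_of_tendsto_of_tendsto ((hγ L).dist (tendsto_const_nhds (x := x))) h0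
      (Eventually.of_forall fun n => ?_))
    have := dist_le_chainLength_sub (q n) (hiN n L)
    rwa [hend n] at this
  have hγ0 : Tendsto (fun n => q n 0) U (𝓝 (γ 0)) := by
    refine (hγ 0).congr_dist (squeeze_zero (fun _ => dist_nonneg) (fun n => ?_)
      (hlenlim 0 le_rfl hL0))
    rw [dist_comm]
    have := dist_le_chainLength_sub (q n) (Nat.zero_le (i n 0))
    simpa [chainLength] using this
  have hvI : v (γ 0) + ENNReal.ofReal I ≤ c := by
    have hIc : ENNReal.ofReal I ≤ c :=
      (ENNReal.ofReal_le_iff_le_toReal hc).2 (le_of_tendsto hI (Eventually.of_forall hcr))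
    have : v (γ 0) ≤ c - ENNReal.ofReal I := by
      -- Lower semicontinuity keeps `v (q n 0)` above any level below `v (γ 0)`, while the costs
      -- converge to `I`.
      refine le_of_forall_lt fun y hy => ?_
      obtain ⟨z, hyz, hz⟩ := exists_between hy
      refine hyz.trans_le (ENNReal.le_sub_of_add_le_right ENNReal.ofReal_ne_top ?_)
      have h1 : ∀ᶠ n in (U : Filter ℕ), z < v (q n 0) := hγ0.eventually (hv (γ 0) z hz)
      refine le_of_tendsto ((ENNReal.continuous_ofReal.tendsto I).comp hI |>.const_add z) ?_
      filter_upwards [h1] with n hn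
      exact (add_le_add_left hn.le _).trans (hcost n)
    exact (add_le_add_left this _).trans (tsub_add_cancel_of_le hIc).le
  have hint : ∀ k, ∫⁻ t in Icc 0 L, (g k (γ t) : ℝ≥0∞) ≤ ENNReal.ofReal I := by
    intro k
    obtain ⟨K, hK⟩ := hlip k
    have hcont : ContinuousOn (fun t => (g k (γ t) : ℝ)) (Icc 0 L) :=
      (NNReal.continuous_coe.comp hK.continuous).comp_continuousOn hγlip.continuousOn
    have h1 : ∫ t in (0 : ℝ)..L, (g k (γ t) : ℝ) ≤ A L - A 0 := by
      -- Fix `k` and pass to the limit in the discrete increments, using `g k ≤ g n` for `n ≥ k`.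
      -- The limit inequality holds at every scale, so the scale `1` is arbitrary.
      refine integral_le_of_increments (C := K) hL0 one_pos (fun s t hs hst ht => ?_)
        fun s t hs hst ht _ => ?_
      · have h2 := hK.dist_le_mul (γ t) (γ s)
        rw [NNReal.dist_eq] at h2
        refine h2.trans (mul_le_mul_of_nonneg_left ?_ K.2)
        rw [dist_comm]
        exact hdist s t hs hst ht
      · have hd := (hlenlim t (hs.trans hst) ht).sub (hlenlim s hs (hst.trans ht))
        have hg : Tendsto (fun n => (g k (q n (i n s)) : ℝ)) U (𝓝 (g k (γ s))) :=
          ((NNReal.continuous_coe.comp hK.continuous).tendsto _).comp (hγ s)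
        refine le_of_tendsto_of_tendsto ((hg.sub (hd.const_mul (K : ℝ))).mul hd)
          ((hA t).sub (hA s)) (hU ?_)
        filter_upwards [eventually_ge_atTop k] with n hn
        exact lipschitz_chainCost_sub_ge hK (hmono hn) (q n) (himono n hst)
    have h2 : A L - A 0 ≤ I := by
      have h3 : A L ≤ I := le_of_tendsto_of_tendsto (hA L) hI
        (Eventually.of_forall fun n => chainCost_mono _ _ (hiN n L))
      have h4 : 0 ≤ A 0 := ge_of_tendsto (hA 0) (Eventually.of_forall fun n =>
        chainCost_nonneg _ _ _)
      linarith
    refine le_trans (le_of_eq ?_) (ENNReal.ofReal_le_ofReal (h1.trans h2))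
    rw [intervalIntegral.integral_of_le hL0, ← integral_Icc_eq_integral_Ioc,
      ofReal_integral_eq_lintegral_ofReal hcont.integrableOn_Icc
        (Eventually.of_forall fun t => (g k (γ t)).2)]
    exact lintegral_congr fun t => by simp
  refine ⟨L, γ, hL0, hγlip, hγL, (add_le_add_right ?_ _).trans hvI⟩
  rw [lintegral_iSup' (f := fun n t => (g n (γ t) : ℝ≥0∞)) (fun k => ?_) (Eventually.of_forall fun t n m hnm =>
    ENNReal.coe_le_coe.2 (hmono hnm _))]
  · exact iSup_le hint
  · obtain ⟨K, hK⟩ := hlip k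
    exact ((ENNReal.continuous_coe.comp hK.continuous).comp_continuousOn
      hγlip.continuousOn).aemeasurable measurableSet_Icc

end Chains

section Approximation

variable {X : Type*} [MetricSpace X]

/-! ### Lipschitz envelopes -/

/-- The `n`-Lipschitz envelope of `min G n`. -/
noncomputable def lipEnvelope (G : X → ℝ≥0∞) (n : ℕ) (x : X) : ℝ≥0 :=
  (⨅ y, min (G y) n + n * edist x y).toNNReal

lemma lipEnvelope_inf_le (G : X → ℝ≥0∞) (n : ℕ) (x : X) :
    ⨅ y, min (G y) n + n * edist x y ≤ min (G x) n :=
  (iInf_le _ x).trans (by simp)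

lemma coe_lipEnvelope (G : X → ℝ≥0∞) (n : ℕ) (x : X) :
    (lipEnvelope G n x : ℝ≥0∞) = ⨅ y, min (G y) n + n * edist x y :=
  ENNReal.coe_toNNReal (ne_top_of_le_ne_top (ENNReal.natCast_ne_top n)
    ((lipEnvelope_inf_le G n x).trans (min_le_right _ _)))

lemma coe_lipEnvelope_le (G : X → ℝ≥0∞) (n : ℕ) (x : X) : (lipEnvelope G n x : ℝ≥0∞) ≤ G x := by
  rw [coe_lipEnvelope]
  exact (lipEnvelope_inf_le G n x).trans (min_le_left _ _)

lemma lipEnvelope_le_natCast (G : X → ℝ≥0∞) (n : ℕ) (x : X) : lipEnvelope G n x ≤ n := by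
  have := (lipEnvelope_inf_le G n x).trans (min_le_right _ _)
  rw [← coe_lipEnvelope] at this
  exact_mod_cast this

lemma lipschitzWith_lipEnvelope (G : X → ℝ≥0∞) (n : ℕ) :
    LipschitzWith n (lipEnvelope G n) := by
  have key : ∀ x y, (lipEnvelope G n x : ℝ≥0∞) ≤ lipEnvelope G n y + n * edist x y := by
    intro x y
    rw [coe_lipEnvelope, coe_lipEnvelope, ENNReal.iInf_add]
    refine le_iInf fun z => (iInf_le _ z).trans ?_
    rw [add_assoc, ← mul_add]
    gcongr
    rw [add_comm]
    exact edist_triangle x y z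
  have key' : LipschitzWith n fun x => (lipEnvelope G n x : ℝ) := by
    refine LipschitzWith.of_le_add_mul _ fun x y => ?_
    have h := ENNReal.toReal_mono (by finiteness) (key x y)
    rw [ENNReal.toReal_add (by finiteness) (by finiteness), ENNReal.toReal_mul, edist_dist,
      ENNReal.toReal_ofReal dist_nonneg] at h
    simpa using h
  exact fun x y => key' x y

lemma lipEnvelope_mono (G : X → ℝ≥0∞) : Monotone (lipEnvelope G) := by
  intro n m hnm x
  rw [← ENNReal.coe_le_coe, coe_lipEnvelope, coe_lipEnvelope]
  have : (n : ℝ≥0∞) ≤ m := by exact_mod_cast hnm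
  gcongr

/-- A competitor `y` is expensive either through `G y` or through its distance penalty `n * r`. This
one criterion gives convergence of the envelopes (`r` from semicontinuity), their uniform lower
bound (`r = ∞`) and their coercivity. -/
lemma le_lipEnvelope {G : X → ℝ≥0∞} {n : ℕ} {x : X} {c : ℝ≥0∞} {r : ℝ≥0∞}
    (h : ∀ y, c ≤ G y ∨ r ≤ edist x y) (hn : c ≤ n) (hr : c ≤ n * r) :
    c ≤ lipEnvelope G n x := by
  rw [coe_lipEnvelope]
  refine le_iInf fun y => ?_
  rcases h y with hy | hy
  · exact (le_min hy hn).trans le_self_add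
  · exact (hr.trans (by gcongr)).trans le_add_self

lemma iSup_lipEnvelope {G : X → ℝ≥0∞} (hG : LowerSemicontinuous G) (x : X) :
    ⨆ n, (lipEnvelope G n x : ℝ≥0∞) = G x := by
  refine le_antisymm (iSup_le fun n => coe_lipEnvelope_le G n x) (le_of_forall_lt fun c hc => ?_)
  obtain ⟨d, hcd, hd⟩ := exists_between hc
  obtain ⟨r, hr, hball⟩ := EMetric.mem_nhds_iff.1 (hG x d hd)
  have hdt : d ≠ ∞ := hd.ne_top
  obtain ⟨n₁, hn₁⟩ := ENNReal.exists_nat_gt hdt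
  obtain ⟨n₂, hn₂⟩ := ENNReal.exists_nat_mul_gt hr.ne' hdt
  refine hcd.trans_le (le_trans ?_ (le_iSup _ (max n₁ n₂)))
  refine le_lipEnvelope (r := r) (fun y => ?_) (hn₁.le.trans (by simp))
    (hn₂.le.trans (by gcongr; simp))
  rcases lt_or_ge (edist x y) r with hy | hy
  · left
    have : y ∈ Metric.eball x r := by rwa [Metric.mem_eball, edist_comm]
    exact (hball this).le
  · exact Or.inr hy

/-! ### Minimal functions along chains -/

/-- The largest function below `v` and `M` whose oscillation along `ε`-steps is controlled
by `h`. -/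
noncomputable def chainMin (h : X → ℝ≥0) (v : X → ℝ≥0∞) (ε : ℝ) (M : ℝ≥0) (x : X) : ℝ≥0∞ :=
  min M (⨅ (q : ℕ → X) (N : ℕ) (_ : (∀ j < N, dist (q j) (q (j + 1)) ≤ ε) ∧ q N = x),
    v (q 0) + ENNReal.ofReal (chainCost h q N))

lemma chainMin_le_const (h : X → ℝ≥0) (v : X → ℝ≥0∞) (ε : ℝ) (M : ℝ≥0) (x : X) :
    chainMin h v ε M x ≤ M := min_le_left _ _

lemma chainMin_ne_top (h : X → ℝ≥0) (v : X → ℝ≥0∞) (ε : ℝ) (M : ℝ≥0) (x : X) :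
    chainMin h v ε M x ≠ ∞ := ne_top_of_le_ne_top ENNReal.coe_ne_top (chainMin_le_const h v ε M x)

lemma chainMin_le_of_chain {h : X → ℝ≥0} {v : X → ℝ≥0∞} {ε : ℝ} {M : ℝ≥0} {x : X} {q : ℕ → X}
    {N : ℕ} (hq : ∀ j < N, dist (q j) (q (j + 1)) ≤ ε) (hN : q N = x) :
    chainMin h v ε M x ≤ v (q 0) + ENNReal.ofReal (chainCost h q N) :=
  (min_le_right _ _).trans (iInf₂_le_of_le q N (iInf_le _ ⟨hq, hN⟩))

lemma chainMin_le (h : X → ℝ≥0) (v : X → ℝ≥0∞) (ε : ℝ) (M : ℝ≥0) (x : X) :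
    chainMin h v ε M x ≤ v x := by
  simpa [chainCost] using chainMin_le_of_chain (h := h) (v := v) (ε := ε) (M := M)
    (q := fun _ => x) (N := 0) (by simp) rfl

lemma exists_chain_of_chainMin_lt {h : X → ℝ≥0} {v : X → ℝ≥0∞} {ε : ℝ} {M : ℝ≥0} {x : X}
    {c : ℝ≥0∞} (hc : chainMin h v ε M x < c) (hcM : c ≤ M) :
    ∃ (q : ℕ → X) (N : ℕ), (∀ j < N, dist (q j) (q (j + 1)) ≤ ε) ∧ q N = x ∧
      v (q 0) + ENNReal.ofReal (chainCost h q N) < c := by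
  rcases min_lt_iff.1 hc with h1 | h1
  · exact absurd h1 (not_lt.2 hcM)
  · simp only [iInf_lt_iff] at h1
    obtain ⟨q, N, ⟨h1, h2⟩, h3⟩ := h1
    exact ⟨q, N, h1, h2, h3⟩

lemma chainMin_mono {h h' : X → ℝ≥0} (hh : h ≤ h') (v : X → ℝ≥0∞) {ε ε' : ℝ} (hε : ε' ≤ ε)
    (M : ℝ≥0) (x : X) : chainMin h v ε M x ≤ chainMin h' v ε' M x := by
  refine le_min (min_le_left _ _) (le_iInf fun q => le_iInf fun N => le_iInf fun hq => ?_)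
  refine (chainMin_le_of_chain (fun j hj => (hq.1 j hj).trans hε) hq.2).trans ?_
  gcongr
  exact Finset.sum_le_sum fun j _ => mul_le_mul_of_nonneg_right
    (by have h1 : (h (q j) : ℝ) ≤ h' (q j) := hh _
        have h2 : (h (q (j + 1)) : ℝ) ≤ h' (q (j + 1)) := hh _
        linarith) dist_nonneg

lemma chainMin_step (h : X → ℝ≥0) (v : X → ℝ≥0∞) {ε : ℝ} (M : ℝ≥0) {x y : X}
    (hxy : dist x y ≤ ε) :
    chainMin h v ε M y ≤
      chainMin h v ε M x + ENNReal.ofReal (((h x : ℝ) + h y) / 2 * dist x y) := by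
  rw [← tsub_le_iff_right]
  refine le_min (tsub_le_iff_right.2 ((min_le_left _ _).trans le_self_add))
    (le_iInf fun q => le_iInf fun N => le_iInf fun hq => ?_)
  rw [tsub_le_iff_right]
  -- A chain ending at `x`, prolonged by `y`, competes in the infimum at `y`.
  set q' : ℕ → X := fun i => if i ≤ N then q i else y with hq'
  have h1 : ∀ i ≤ N, q' i = q i := fun i hi => by simp [hq', hi]
  have h2 : q' (N + 1) = y := by simp [hq']
  have hcost : chainCost h q' N = chainCost h q N := Finset.sum_congr rfl fun j hj => by
    have := Finset.mem_range.1 hj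
    rw [h1 j (by omega), h1 (j + 1) (by omega)]
  have h3 := chainMin_le_of_chain (h := h) (v := v) (ε := ε) (M := M) (x := y) (q := q')
    (N := N + 1) (fun j hj => by
      rcases Nat.lt_succ_iff_lt_or_eq.1 hj with hj' | rfl
      · rw [h1 j hj'.le, h1 (j + 1) hj']; exact hq.1 j hj'
      · rwa [h1 j le_rfl, h2, hq.2]) h2
  rw [chainCost, Finset.sum_range_succ, ← chainCost, hcost, h1 N le_rfl, h2, hq.2,
    ENNReal.ofReal_add (chainCost_nonneg _ _ _) (by positivity), h1 0 (Nat.zero_le N),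
    ← add_assoc] at h3
  exact h3

lemma abs_toReal_chainMin_sub_le (h : X → ℝ≥0) (v : X → ℝ≥0∞) {ε : ℝ} (M : ℝ≥0) {x y : X}
    (hxy : dist x y ≤ ε) :
    |(chainMin h v ε M y).toReal - (chainMin h v ε M x).toReal| ≤
      ((h x : ℝ) + h y) / 2 * dist x y := by
  have key : ∀ x y : X, dist x y ≤ ε → (chainMin h v ε M y).toReal ≤
      (chainMin h v ε M x).toReal + ((h x : ℝ) + h y) / 2 * dist x y := by
    intro x y hxy
    have := ENNReal.toReal_mono (ENNReal.add_ne_top.2 ⟨chainMin_ne_top _ _ _ _ _,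
      ENNReal.ofReal_ne_top⟩) (chainMin_step h v M hxy)
    rwa [ENNReal.toReal_add (chainMin_ne_top _ _ _ _ _) ENNReal.ofReal_ne_top,
      ENNReal.toReal_ofReal (by positivity)] at this
  have h1 := key x y hxy
  have h2 := key y x (by rwa [dist_comm])
  rw [dist_comm y x, add_comm (h y : ℝ)] at h2
  exact abs_le.2 ⟨by linarith, by linarith⟩

/-- Nearby points use the step bound with `h ≤ B`; points farther apart than `ε` use the oscillation
bound `2 * M`. -/
lemma isLip_of_step {w : X → ℝ} {h : X → ℝ≥0} {B M ε : ℝ} (hε : 0 < ε)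
    (hstep : ∀ x y, dist x y ≤ ε → |w y - w x| ≤ ((h x : ℝ) + h y) / 2 * dist x y)
    (hB : ∀ x, h x ≤ B) (hM : ∀ x, |w x| ≤ M) : IsLip w := by
  refine ⟨(max B (2 * M / ε)).toNNReal, LipschitzWith.of_dist_le_mul fun x y => ?_⟩
  refine le_trans ?_ (mul_le_mul_of_nonneg_right (Real.le_coe_toNNReal _) dist_nonneg)
  rw [dist_comm (w x), Real.dist_eq]
  rcases le_or_gt (dist x y) ε with hxy | hxy
  · refine (hstep x y hxy).trans (mul_le_mul_of_nonneg_right (le_trans ?_ (le_max_left _ _))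
      dist_nonneg)
    linarith [hB x, hB y]
  · have h0 : 0 ≤ M := (abs_nonneg _).trans (hM x)
    have h1 : |w y - w x| ≤ 2 * M := (abs_sub _ _).trans (by linarith [hM x, hM y])
    refine (h1.trans ?_).trans (mul_le_mul_of_nonneg_right (le_max_right _ _) dist_nonneg)
    rw [div_mul_eq_mul_div, le_div_iff₀ hε]
    exact mul_le_mul_of_nonneg_left hxy.le (by positivity)

/-- Chain minimizers recover a function from its upper gradients. -/
lemma le_iSup_chainMin [CompleteSpace X] [MeasurableSpace X] {u : X → ℝ} {g : X → ℝ≥0∞}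
    (hg : g ∈ UG u) {M : ℝ≥0} (hu : ∀ x, 0 ≤ u x) (huM : ∀ x, u x ≤ M) {G : X → ℝ≥0∞}
    (hG : LowerSemicontinuous G) (hgG : ∀ x, g x ≤ G x) {η : ℝ} (hη : 0 < η)
    (hGη : ∀ x, ENNReal.ofReal η ≤ G x)
    (hcoer : ∀ m : ℝ, ∃ K : Set X, IsCompact K ∧ ∀ y, y ∉ K → ENNReal.ofReal m ≤ G y)
    {v : X → ℝ≥0∞} (hv : LowerSemicontinuous v) (huv : ∀ x, ENNReal.ofReal (u x) ≤ v x) (x : X) :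
    ENNReal.ofReal (u x) ≤ ⨆ n : ℕ, chainMin (lipEnvelope G n) v (1 / ((n : ℝ) + 1)) M x := by
  by_contra hcon
  obtain ⟨c, hc1, hc2⟩ := exists_between (not_le.1 hcon)
  -- Below `M` the truncation in `chainMin` is inactive, so cheap chains exist.
  have hcM : c ≤ M := hc2.le.trans (ENNReal.ofReal_le_coe.2 (huM x))
  choose q N hstep hend hcost using fun n : ℕ =>
    exists_chain_of_chainMin_lt ((le_iSup (fun n : ℕ =>
      chainMin (lipEnvelope G n) v (1 / ((n : ℝ) + 1)) M x) n).trans_lt hc1) hcM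
  have hcoe : ∀ {a : ℝ} {b : ℝ≥0}, ENNReal.ofReal a ≤ b → a ≤ b := fun h =>
    ENNReal.ofReal_le_coe.1 h
  obtain ⟨L, γ, hL, hγ, hγL, hγc⟩ := exists_curve_of_chains
    (fun n => ⟨n, lipschitzWith_lipEnvelope G n⟩) (lipEnvelope_mono G) hη
    (by
      filter_upwards [eventually_ge_atTop ⌈η⌉₊] with n hn y
      refine hcoe (le_lipEnvelope (r := ∞) (fun z => Or.inl (hGη z)) ?_ ?_)
      · exact ENNReal.ofReal_le_natCast.2 (Nat.ceil_le.1 hn)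
      · have : (n : ℝ≥0∞) ≠ 0 := by
          have := (Nat.ceil_pos.2 hη).trans_le hn
          exact_mod_cast this.ne'
        simp [ENNReal.mul_top this])
    (by
      intro m ρ hρ
      obtain ⟨K, hK, hKm⟩ := hcoer m
      refine ⟨K, hK, ?_⟩
      filter_upwards [eventually_ge_atTop ⌈m⌉₊, eventually_ge_atTop ⌈m / ρ⌉₊] with n hn hn' y hy
      refine hcoe (le_lipEnvelope (r := ENNReal.ofReal ρ) (fun z => ?_) ?_ ?_)
      · by_cases hz : z ∈ K
        · right
          by_contra hlt
          refine hy (Metric.mem_thickening_iff.2 ⟨z, hz, ?_⟩)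
          rw [not_le, edist_dist] at hlt
          exact (ENNReal.ofReal_lt_ofReal_iff hρ).1 hlt
        · exact Or.inl (hKm z hz)
      · exact ENNReal.ofReal_le_natCast.2 (Nat.ceil_le.1 hn)
      · rw [← ENNReal.ofReal_natCast, ← ENNReal.ofReal_mul (by positivity)]
        exact ENNReal.ofReal_le_ofReal ((div_le_iff₀ hρ).1 (Nat.ceil_le.1 hn')))
    hv (hc2.ne_top) tendsto_one_div_add_atTop_nhds_zero_nat hstep hend fun n => (hcost n).le
  simp only [iSup_lipEnvelope hG] at hγc
  refine absurd hc2 (not_lt.2 (le_trans ?_ hγc))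
  -- For `L = 0` the limit is the single point `x`, not a rectifiable curve, and `u ≤ v` suffices.
  rcases hL.eq_or_lt with rfl | hL
  · rw [← hγL]
    exact (huv _).trans le_self_add
  · have h1 := hg.2 γ 0 L (isRectifiableCurve_of_lipschitzOnWith hL hγ)
    rw [hγL] at h1
    have h2 : u x ≤ u (γ 0) + |u x - u (γ 0)| := by linarith [le_abs_self (u x - u (γ 0))]
    refine (ENNReal.ofReal_le_ofReal h2).trans ?_
    rw [ENNReal.ofReal_add (hu _) (abs_nonneg _)]
    exact add_le_add (huv _) (h1.trans ((curveIntegral_le_lintegral hL hγ g).trans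
      (lintegral_mono fun t => hgG _)))

/-! ### Approximation with respect to finite measures -/

/-- From `|f|^p ≤ M^(p-1) * |f|`: for bounded functions, smallness in `L¹` gives smallness in `L^p`.
-/
lemma eLpNorm_le_of_enorm_le {α : Type*} [MeasurableSpace α] {p : ℝ≥0∞} (hp : 1 ≤ p) (hp' : p ≠ ∞) {ν : Measure α}
    {f : α → ℝ} {M : ℝ≥0} (hf : ∀ x, ‖f x‖ₑ ≤ M) :
    eLpNorm f p ν ≤ ((M : ℝ≥0∞) ^ (p.toReal - 1) * ∫⁻ x, ‖f x‖ₑ ∂ν) ^ (1 / p.toReal) := by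
  have hp0 : p ≠ 0 := (zero_lt_one.trans_le hp).ne'
  have hr1 : 1 ≤ p.toReal := by
    rw [← ENNReal.toReal_one]
    exact ENNReal.toReal_mono hp' hp
  rw [eLpNorm_eq_lintegral_rpow_enorm_toReal hp0 hp', ← lintegral_const_mul' _ _
    (ENNReal.rpow_ne_top_of_nonneg (by linarith) ENNReal.coe_ne_top)]
  refine ENNReal.rpow_le_rpow (lintegral_mono fun x => ?_) (by positivity)
  calc ‖f x‖ₑ ^ p.toReal = ‖f x‖ₑ ^ (p.toReal - 1) * ‖f x‖ₑ := by
        conv_rhs => rw [← ENNReal.rpow_one ‖f x‖ₑ, ← ENNReal.rpow_mul, one_mul]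
        rw [← ENNReal.rpow_add_of_nonneg _ _ (by linarith) zero_le_one]
        ring_nf
    _ ≤ _ := by
        gcongr
        exact hf x

variable [MeasurableSpace X] [BorelSpace X]

/-- Work with `p`-th powers: add to a lower semicontinuous majorant of `g ^ p` (Vitali–Carathéodory)
a small constant and the penalties `m ^ p` off compact sets `K m`, whose complements have tiny
measure by tightness. Each of the three errors is at most a third of `(min δ 1) ^ p`; the `p`-th
root is subadditive. -/
lemma exists_coercive_majorant [CompleteSpace X] [SecondCountableTopology X] (ν : Measure X)
    [IsFiniteMeasure ν] {p : ℝ≥0∞} (hp : 1 ≤ p) (hp' : p ≠ ∞) {g : X → ℝ≥0∞} (hg : Measurable g)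
    {δ : ℝ≥0∞} (hδ : δ ≠ 0) :
    ∃ G : X → ℝ≥0∞, LowerSemicontinuous G ∧ (∀ x, g x ≤ G x) ∧
      eLpNorm G p ν ≤ eLpNorm g p ν + δ ∧ (∃ η : ℝ, 0 < η ∧ ∀ x, ENNReal.ofReal η ≤ G x) ∧
      ∀ m : ℝ, ∃ K : Set X, IsCompact K ∧ ∀ y, y ∉ K → ENNReal.ofReal m ≤ G y := by
  have hp0 : p ≠ 0 := (zero_lt_one.trans_le hp).ne'
  set r := p.toReal with hr
  have hr1 : 1 ≤ r := by
    rw [hr, ← ENNReal.toReal_one]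
    exact ENNReal.toReal_mono hp' hp
  have hr0 : 0 < r := zero_lt_one.trans_le hr1
  set d : ℝ≥0∞ := (min δ 1) ^ r / 3 with hd
  have hδ1 : min δ 1 ≠ 0 := (lt_min (pos_iff_ne_zero.2 hδ) zero_lt_one).ne'
  have hδ1' : min δ 1 ≠ ∞ := ne_top_of_le_ne_top ENNReal.one_ne_top (min_le_right _ _)
  have hd0 : d ≠ 0 := by
    refine (ENNReal.div_pos ?_ (by norm_num)).ne'
    exact (ENNReal.rpow_pos (pos_iff_ne_zero.2 hδ1) hδ1').ne'
  obtain ⟨g₀, hg₀, hg₀lsc, hg₀int⟩ :=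
    exists_le_lowerSemicontinuous_lintegral_ge ν (fun x => g x ^ r) (hg.pow_const r) hd0
  obtain ⟨e, he0, hesum⟩ := ENNReal.exists_pos_sum_of_countable' hd0 ℕ
  have hK : ∀ m : ℕ, ∃ K : Set X, IsCompact K ∧ ν Kᶜ ≤ e m / (m : ℝ≥0∞) ^ r := by
    intro m
    obtain ⟨K, hK, hKν⟩ := isTightMeasureSet_iff_exists_isCompact_measure_compl_le.1
      (isTightMeasureSet_singleton (μ := ν)) (e m / (m : ℝ≥0∞) ^ r)
      (ENNReal.div_pos (he0 m).ne' (by finiteness))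
    exact ⟨K, hK, hKν ν rfl⟩
  choose K hKc hKν using hK
  -- The cap at `1` keeps `c₀` finite when `ν = 0`.
  set c₀ : ℝ≥0∞ := min 1 (d / ν univ) with hc₀
  have hc₀0 : 0 < c₀ := lt_min zero_lt_one (ENNReal.div_pos hd0 (by finiteness))
  have hc₀t : c₀ ≠ ∞ := ne_top_of_le_ne_top ENNReal.one_ne_top (min_le_left _ _)
  set pen : ℕ → X → ℝ≥0∞ := fun m => (K m)ᶜ.indicator fun _ => (m : ℝ≥0∞) ^ r with hpen
  have hpenlsc : ∀ m, LowerSemicontinuous (pen m) := fun m =>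
    (hKc m).isClosed.isOpen_compl.lowerSemicontinuous_indicator zero_le
  set G₀ : X → ℝ≥0∞ := fun x => g₀ x + (c₀ + ∑' m, pen m x) with hG₀
  have hG₀lsc : LowerSemicontinuous G₀ :=
    hg₀lsc.add (lowerSemicontinuous_const.add (lowerSemicontinuous_tsum hpenlsc))
  have hmono : Monotone fun t : ℝ≥0∞ => t ^ (1 / r) := fun a b hab =>
    ENNReal.rpow_le_rpow hab (by positivity)
  have hroot : ∀ {a : ℝ≥0∞} {x : X}, a ^ r ≤ G₀ x → a ≤ G₀ x ^ (1 / r) := fun {a x} h => by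
    have := hmono h
    simp only at this
    rwa [← ENNReal.rpow_mul, mul_one_div_cancel hr0.ne', ENNReal.rpow_one] at this
  refine ⟨fun x => G₀ x ^ (1 / r), ?_, fun x => hroot ((hg₀ x).trans le_self_add), ?_,
    ⟨(c₀ ^ (1 / r)).toReal, ?_, fun x => ?_⟩, fun m => ?_⟩
  · exact (ENNReal.continuous_rpow_const (y := 1 / r)).comp_lowerSemicontinuous hG₀lsc hmono
  · have hpenint : ∫⁻ x, ∑' m, pen m x ∂ν ≤ d := by
      rw [lintegral_tsum fun m => (hpenlsc m).measurable.aemeasurable]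
      refine (ENNReal.tsum_le_tsum fun m => ?_).trans hesum.le
      rw [hpen, lintegral_indicator_const (hKc m).isClosed.measurableSet.compl]
      exact (mul_le_mul_right (hKν m) _).trans ENNReal.mul_div_le
    have hG₀int : ∫⁻ x, G₀ x ∂ν ≤ (∫⁻ x, g x ^ r ∂ν) + (min δ 1) ^ r := by
      rw [hG₀, lintegral_add_left hg₀lsc.measurable, lintegral_add_left measurable_const,
        lintegral_const]
      have h1 : c₀ * ν univ ≤ d := by
        rw [mul_comm]
        exact (mul_le_mul_right (min_le_right _ _) _).trans ENNReal.mul_div_le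
      have h3 : d + (d + d) = (min δ 1) ^ r := by
        rw [← add_assoc]
        exact ENNReal.add_thirds _
      calc _ ≤ ((∫⁻ x, g x ^ r ∂ν) + d) + (d + d) :=
            add_le_add hg₀int (add_le_add h1 hpenint)
        _ = _ := by rw [add_assoc, h3]
    rw [eLpNorm_eq_lintegral_rpow_enorm_toReal hp0 hp',
      eLpNorm_eq_lintegral_rpow_enorm_toReal hp0 hp']
    simp only [enorm_eq_self, ← hr, ← ENNReal.rpow_mul, one_div_mul_cancel hr0.ne',
      ENNReal.rpow_one]
    refine (hmono hG₀int).trans ((ENNReal.rpow_add_le_add_rpow _ _ (by positivity)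
      ((div_le_one hr0).2 hr1)).trans (add_le_add_right ?_ _))
    rw [← ENNReal.rpow_mul, mul_one_div_cancel hr0.ne', ENNReal.rpow_one]
    exact min_le_left _ _
  · exact ENNReal.toReal_pos (ENNReal.rpow_pos hc₀0 hc₀t).ne'
      (ENNReal.rpow_ne_top_of_nonneg (by positivity) hc₀t)
  · rw [ENNReal.ofReal_toReal (ENNReal.rpow_ne_top_of_nonneg (by positivity) hc₀t)]
    exact hmono (le_self_add.trans le_add_self)
  · refine ⟨K ⌈m⌉₊, hKc _, fun y hy => ?_⟩
    refine (ENNReal.ofReal_le_natCast.2 (Nat.le_ceil m)).trans (hroot ?_)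
    refine le_trans ?_ (le_add_self.trans le_add_self)
    refine le_trans (le_of_eq ?_) (ENNReal.le_tsum ⌈m⌉₊)
    simp [hpen, hy]

lemma exists_approximation_of_isFiniteMeasure [CompleteSpace X] [SecondCountableTopology X]
    (ν : Measure X) [IsFiniteMeasure ν] {p : ℝ≥0∞} (hp : 1 ≤ p) (hp' : p ≠ ∞) {u : X → ℝ}
    {M : ℝ≥0} (hu : ∀ x, 0 ≤ u x) (huM : ∀ x, u x ≤ M) (hum : AEMeasurable u ν)
    {g : X → ℝ≥0∞} (hg : g ∈ UG u) {δ : ℝ≥0∞} (hδ : δ ≠ 0) :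
    ∃ (w : X → ℝ) (h : X → ℝ≥0) (ε B : ℝ), 0 < ε ∧ (∀ x, 0 ≤ w x) ∧ (∀ x, w x ≤ M) ∧ IsLip h ∧
      (∀ x, h x ≤ B) ∧
      (∀ x y, dist x y ≤ ε → |w y - w x| ≤ ((h x : ℝ) + h y) / 2 * dist x y) ∧
      eLpNorm (w - u) p ν ≤ δ ∧
      eLpNorm (fun x => (h x : ℝ≥0∞)) p ν ≤ eLpNorm g p ν + δ := by
  have hr1 : 1 ≤ p.toReal := by
    rw [← ENNReal.toReal_one]
    exact ENNReal.toReal_mono hp' hp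
  obtain ⟨G, hG, hgG, hGp, ⟨η, hη, hGη⟩, hcoer⟩ := exists_coercive_majorant ν hp hp' hg.1 hδ
  set C : ℝ≥0∞ := (M : ℝ≥0∞) ^ (p.toReal - 1) with hC
  have hCt : C ≠ ∞ := ENNReal.rpow_ne_top_of_nonneg (by linarith) ENNReal.coe_ne_top
  -- `d` is the `L¹` budget for each of `v - u` and `(u - W n)⁺`; `C` converts it to `L^p`.
  obtain ⟨d, hd0, hd⟩ : ∃ d : ℝ≥0∞, 0 < d ∧ C * (d + d) ≤ δ ^ p.toReal := by
    have hδp : δ ^ p.toReal ≠ 0 := by simp [hδ]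
    refine ⟨δ ^ p.toReal / C / 2, ENNReal.half_pos (ENNReal.div_pos hδp hCt).ne', ?_⟩
    rw [ENNReal.add_halves]
    exact ENNReal.mul_div_le
  obtain ⟨v, huv, hv, hvint⟩ := exists_lt_lowerSemicontinuous_lintegral_ge_of_aemeasurable ν
    (fun x => (u x).toNNReal) hum.real_toNNReal hd0.ne'
  have huv' : ∀ x, ENNReal.ofReal (u x) ≤ v x := fun x => (huv x).le
  set W : ℕ → X → ℝ≥0∞ := fun n => chainMin (lipEnvelope G n) v (1 / ((n : ℝ) + 1)) M with hW
  have hWmono : ∀ x, Monotone fun n => W n x := fun x n m hnm =>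
    chainMin_mono (lipEnvelope_mono G hnm) v
      (one_div_le_one_div_of_le (by positivity) (by gcongr)) M x
  have hWt : ∀ n x, W n x ≠ ∞ := fun n x => chainMin_ne_top _ _ _ _ _
  have hWM : ∀ n x, (W n x).toReal ≤ M := fun n x =>
    ENNReal.toReal_le_coe_of_le_coe (chainMin_le_const _ _ _ _ _)
  have hstep : ∀ (n : ℕ) x y, dist x y ≤ 1 / ((n : ℝ) + 1) → |(W n y).toReal - (W n x).toReal| ≤
      ((lipEnvelope G n x : ℝ) + lipEnvelope G n y) / 2 * dist x y := fun n x y hxy =>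
    abs_toReal_chainMin_sub_le _ v M hxy
  have hWmeas : ∀ n, Measurable (W n) := fun n => by
    obtain ⟨Kw, hKw⟩ := isLip_of_step (M := M) (by positivity : 0 < 1 / ((n : ℝ) + 1)) (hstep n)
      (fun x => by exact_mod_cast lipEnvelope_le_natCast G n x)
      (fun x => by rw [abs_of_nonneg ENNReal.toReal_nonneg]; exact hWM n x)
    have := hKw.continuous.measurable.ennreal_ofReal
    simpa only [ENNReal.ofReal_toReal (hWt n _)] using this
  have huM' : ∀ x, ENNReal.ofReal (u x) ≤ M := fun x => ENNReal.ofReal_le_coe.2 (huM x)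
  have hum' : AEMeasurable (fun x => ENNReal.ofReal (u x)) ν := hum.ennreal_ofReal
  have hufin : ∫⁻ x, ENNReal.ofReal (u x) ∂ν ≠ ∞ :=
    ne_top_of_le_ne_top (b := ∫⁻ _, (M : ℝ≥0∞) ∂ν) (by simp; finiteness) (lintegral_mono huM')
  have hpart1 : ∫⁻ x, (v x - ENNReal.ofReal (u x)) ∂ν ≤ d := by
    rw [lintegral_sub' hum' hufin (Eventually.of_forall huv')]
    exact tsub_le_iff_left.2 hvint
  -- Truncated subtraction gives `(u - W n)⁺`, which tends to `0` pointwise because `u ≤ sup W n`.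
  have hpart2 : Tendsto (fun n => ∫⁻ x, (ENNReal.ofReal (u x) - W n x) ∂ν) atTop (𝓝 0) := by
    have := tendsto_lintegral_of_dominated_convergence' (μ := ν)
      (F := fun n x => ENNReal.ofReal (u x) - W n x) (f := fun _ => 0) (fun _ => (M : ℝ≥0∞))
      (fun n => hum'.sub (hWmeas n).aemeasurable)
      (fun n => Eventually.of_forall fun x => tsub_le_self.trans (huM' x))
      (by simp; finiteness)
      (Eventually.of_forall fun x => by
        have h1 := tendsto_atTop_iSup (hWmono x)
        have h2 := le_iSup_chainMin hg hu huM hG hgG hη hGη hcoer hv huv' x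
        have h3 := ENNReal.Tendsto.sub (tendsto_const_nhds (x := ENNReal.ofReal (u x))) h1
          (Or.inl ENNReal.ofReal_ne_top)
        rwa [tsub_eq_zero_of_le h2] at h3)
    simpa using this
  obtain ⟨n, hn⟩ := (hpart2.eventually (ge_mem_nhds hd0)).exists
  refine ⟨fun x => (W n x).toReal, lipEnvelope G n, 1 / ((n : ℝ) + 1), n, by positivity,
    fun x => ENNReal.toReal_nonneg, hWM n, ⟨n, lipschitzWith_lipEnvelope G n⟩,
    fun x => by exact_mod_cast lipEnvelope_le_natCast G n x, hstep n, ?_, ?_⟩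
  · have hbound : ∀ x, ‖(W n x).toReal - u x‖ₑ ≤ M := fun x => by
      rw [← ofReal_norm, Real.norm_eq_abs]
      refine ENNReal.ofReal_le_coe.2 (abs_le.2 ⟨?_, ?_⟩)
      · linarith [huM x, ENNReal.toReal_nonneg (a := W n x)]
      · linarith [hWM n x, hu x]
    have hsplit : ∀ x, ‖(W n x).toReal - u x‖ₑ ≤
        (v x - ENNReal.ofReal (u x)) + (ENNReal.ofReal (u x) - W n x) := fun x => by
      rw [← ofReal_norm, Real.norm_eq_abs]
      rcases le_total (u x) (W n x).toReal with h | h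
      · rw [abs_of_nonneg (sub_nonneg.2 h), ENNReal.ofReal_sub _ (hu x),
          ENNReal.ofReal_toReal (hWt n x)]
        exact (tsub_le_tsub_right (chainMin_le _ _ _ _ _) _).trans le_self_add
      · rw [abs_of_nonpos (sub_nonpos.2 h), neg_sub, ENNReal.ofReal_sub _ ENNReal.toReal_nonneg,
          ENNReal.ofReal_toReal (hWt n x)]
        exact le_add_self
    refine (eLpNorm_le_of_enorm_le hp hp' hbound).trans ?_
    have h1 : ∫⁻ x, ‖(W n x).toReal - u x‖ₑ ∂ν ≤ d + d := by
      refine (lintegral_mono hsplit).trans ?_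
      rw [lintegral_add_right' (g := fun x => ENNReal.ofReal (u x) - W n x) _
        (hum'.sub (hWmeas n).aemeasurable)]
      exact add_le_add hpart1 hn
    have h2 : (C * ∫⁻ x, ‖(W n x).toReal - u x‖ₑ ∂ν) ≤ δ ^ p.toReal :=
      (mul_le_mul_right h1 _).trans hd
    refine (ENNReal.rpow_le_rpow h2 (by positivity)).trans (le_of_eq ?_)
    rw [← ENNReal.rpow_mul, mul_one_div_cancel (by linarith), ENNReal.rpow_one]
  · exact (eLpNorm_mono_enorm fun x => by
      simpa only [enorm_eq_self] using coe_lipEnvelope_le G n x).trans hGp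

end Approximation

/-! ### Lipschitz functions -/

section Lipschitz

variable {X : Type*} [MetricSpace X]

lemma isLip_of_abs_sub_le {f : X → ℝ} {K : ℝ} (h : ∀ x y, |f x - f y| ≤ K * dist x y) :
    IsLip f :=
  ⟨K.toNNReal, LipschitzWith.of_dist_le_mul fun x y => (h x y).trans
    (mul_le_mul_of_nonneg_right (Real.le_coe_toNNReal K) dist_nonneg)⟩

lemma IsLip.mul {f g : X → ℝ} (hf : IsLip f) (hg : IsLip g) {A B : ℝ} (hA : ∀ x, |f x| ≤ A)
    (hB : ∀ x, |g x| ≤ B) : IsLip fun x => f x * g x := by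
  obtain ⟨K, hK⟩ := hf
  obtain ⟨L, hL⟩ := hg
  refine isLip_of_abs_sub_le (K := A * L + B * K) fun x y => ?_
  have h1 := hK.dist_le_mul x y
  have h2 := hL.dist_le_mul x y
  rw [Real.dist_eq] at h1 h2
  calc |f x * g x - f y * g y| = |f x * (g x - g y) + g y * (f x - f y)| := by ring_nf
    _ ≤ |f x| * |g x - g y| + |g y| * |f x - f y| := by
        rw [← abs_mul, ← abs_mul]; exact abs_add_le _ _
    _ ≤ A * (L * dist x y) + B * (K * dist x y) := by
        have h3 := mul_le_mul (hA x) h2 (abs_nonneg _) ((abs_nonneg _).trans (hA x))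
        have h4 := mul_le_mul (hB y) h1 (abs_nonneg _) ((abs_nonneg _).trans (hB y))
        linarith
    _ = _ := by ring

/-- The Lipschitz cutoff equal to `1` at distance at most `R - s` and to `0` at distance at
least `R` from `x₀`. -/
noncomputable def cutoff (x₀ : X) (R s : ℝ) (x : X) : ℝ := max 0 (min 1 ((R - dist x x₀) / s))

lemma cutoff_nonneg (x₀ : X) (R s : ℝ) (x : X) : 0 ≤ cutoff x₀ R s x := le_max_left _ _

lemma cutoff_le_one (x₀ : X) (R s : ℝ) (x : X) : cutoff x₀ R s x ≤ 1 :=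
  max_le zero_le_one (min_le_left _ _)

lemma abs_cutoff_le_one (x₀ : X) (R s : ℝ) (x : X) : |cutoff x₀ R s x| ≤ 1 := by
  rw [abs_of_nonneg (cutoff_nonneg _ _ _ _)]
  exact cutoff_le_one _ _ _ _

lemma cutoff_eq_zero {x₀ : X} {R s : ℝ} (hs : 0 < s) {x : X} (h : R ≤ dist x x₀) :
    cutoff x₀ R s x = 0 :=
  max_eq_left ((min_le_right _ _).trans (div_nonpos_of_nonpos_of_nonneg (by linarith) hs.le))

lemma cutoff_eq_one {x₀ : X} {R s : ℝ} (hs : 0 < s) {x : X} (h : dist x x₀ ≤ R - s) :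
    cutoff x₀ R s x = 1 := by
  have : 1 ≤ (R - dist x x₀) / s := by rw [le_div_iff₀ hs]; linarith
  rw [cutoff, min_eq_left this, max_eq_right zero_le_one]

lemma abs_cutoff_sub_le (x₀ : X) (R : ℝ) {s : ℝ} (hs : 0 < s) (x y : X) :
    |cutoff x₀ R s x - cutoff x₀ R s y| ≤ dist x y / s := by
  rw [cutoff, cutoff, max_comm 0, max_comm 0]
  refine (abs_max_sub_max_le_abs _ _ _).trans ?_
  rw [min_comm 1, min_comm 1]
  refine (abs_min_sub_min_le_max _ _ _ _).trans ?_
  rw [sub_self, abs_zero, max_eq_left (abs_nonneg _), ← sub_div, abs_div, abs_of_pos hs]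
  gcongr
  rw [sub_sub_sub_cancel_left, abs_sub_comm]
  exact abs_dist_sub_le x y x₀

lemma isLip_cutoff (x₀ : X) (R : ℝ) {s : ℝ} (hs : 0 < s) : IsLip (cutoff x₀ R s) :=
  isLip_of_abs_sub_le (K := 1 / s) fun x y => by
    rw [one_div, inv_mul_eq_div]
    exact abs_cutoff_sub_le x₀ R hs x y

/-- By the triangle inequality, the chain condition only has to be checked on two-point chains. -/
lemma ofReal_abs_sub_le_chainIntegral {u : X → ℝ} {g : X → ℝ≥0∞} {ε : ℝ}
    (hstep : ∀ x y, dist x y ≤ ε →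
      ENNReal.ofReal |u y - u x| ≤ (g x + g y) / 2 * ENNReal.ofReal (dist x y)) :
    ∀ (N : ℕ) (q : Fin (N + 1) → X), IsEpsChain ε q →
      ENNReal.ofReal |u (q (Fin.last N)) - u (q 0)| ≤ chainIntegral g q := by
  intro N
  induction N with
  | zero => intro q _; simp [chainIntegral]
  | succ N ih =>
    intro q hq
    have h1 := ih (fun i => q i.castSucc) fun i => hq i.castSucc
    have h2 := hstep _ _ (hq (Fin.last N))
    rw [chainIntegral, Fin.sum_univ_castSucc]
    refine le_trans ?_ (add_le_add h1 h2)
    rw [← ENNReal.ofReal_add (abs_nonneg _) (abs_nonneg _)]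
    refine ENNReal.ofReal_le_ofReal ?_
    have := abs_sub_le (u (q (Fin.last (N + 1)))) (u (q (Fin.last N).castSucc)) (u (q 0))
    simp only [Fin.succ_last, Fin.castSucc_zero]
    linarith

lemma mem_chainLUG_of_step [MeasurableSpace X] [BorelSpace X] {u : X → ℝ} {f : X → ℝ≥0}
    (hf : IsLip f) {ε : ℝ}
    (hstep : ∀ x y, dist x y ≤ ε → |u y - u x| ≤ ((f x : ℝ) + f y) / 2 * dist x y) :
    (fun x => (f x : ℝ≥0∞)) ∈ chainLUG ε u := by
  obtain ⟨K, hK⟩ := hf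
  refine ⟨⟨hK.continuous.measurable.coe_nnreal_ennreal,
    ofReal_abs_sub_le_chainIntegral fun x y hxy => ?_⟩, f, ⟨K, hK⟩, rfl⟩
  refine (ENNReal.ofReal_le_ofReal (hstep x y hxy)).trans (le_of_eq ?_)
  rw [ENNReal.ofReal_mul (by positivity), ENNReal.ofReal_div_of_pos (by norm_num),
    ENNReal.ofReal_add (by positivity) (by positivity)]
  simp

end Lipschitz

/-! ### Density in energy -/

section Density

lemma tendsto_eLpNorm_zero_of_dominated {α : Type*} [MeasurableSpace α] {μ : Measure α}
    {p : ℝ≥0∞} (hp : 1 ≤ p) (hp' : p ≠ ∞) {u : α → ℝ} (hu : MemLp u p μ) {f : ℕ → α → ℝ}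
    (hf : ∀ n, AEStronglyMeasurable (f n) μ) (hle : ∀ n x, |f n x| ≤ |u x|)
    (hlim : ∀ x, Tendsto (fun n => f n x) atTop (𝓝 0)) :
    Tendsto (fun n => eLpNorm (f n) p μ) atTop (𝓝 0) := by
  have hp0 : p ≠ 0 := (zero_lt_one.trans_le hp).ne'
  have hr0 : 0 < p.toReal := ENNReal.toReal_pos hp0 hp'
  have hint : ∫⁻ x, ‖u x‖ₑ ^ p.toReal ∂μ ≠ ∞ :=
    (lintegral_rpow_enorm_lt_top_of_eLpNorm_lt_top hp0 hp' hu.2).ne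
  have h1 := tendsto_lintegral_of_dominated_convergence' (μ := μ)
    (F := fun n x => ‖f n x‖ₑ ^ p.toReal) (f := fun _ => 0) (fun x => ‖u x‖ₑ ^ p.toReal)
    (fun n => (hf n).enorm.pow_const _)
    (fun n => Eventually.of_forall fun x => by
      refine ENNReal.rpow_le_rpow ?_ hr0.le
      rw [Real.enorm_eq_ofReal_abs, Real.enorm_eq_ofReal_abs]
      exact ENNReal.ofReal_le_ofReal (hle n x)) hint
    (Eventually.of_forall fun x => by
      have h2 := (hlim x).enorm.ennrpow_const p.toReal
      simpa [hr0] using h2)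
  have h2 := h1.ennrpow_const (1 / p.toReal)
  simp only [lintegral_zero, one_div, ENNReal.zero_rpow_of_pos (inv_pos.2 hr0)] at h2
  refine h2.congr fun n => ?_
  rw [eLpNorm_eq_lintegral_rpow_enorm_toReal hp0 hp', one_div]

lemma relaxation_mono {X : Type*} [MeasurableSpace X] {μ : Measure X} {p : ℝ≥0∞}
    {F F' : (X → ℝ) → ℝ≥0∞} (h : ∀ u, F u ≤ F' u) (u : X → ℝ) :
    relaxation p μ F u ≤ relaxation p μ F' u :=
  iInf_mono fun v => iInf_mono fun _ => iInf_mono fun _ =>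
    liminf_le_liminf (Eventually.of_forall fun j => h (v j))

variable {X : Type*} [MetricSpace X] [CompleteSpace X] [SecondCountableTopology X]
  [MeasurableSpace X] [BorelSpace X] {μ : Measure X} {p : ℝ≥0∞}

/-- Approximate on a large ball, where `μ` is finite, and multiply by a cutoff `ψ` of slope `1 / r`;
its contribution `|w₁| / r` to the gradient is small in norm. A second cutoff `χ` kills the gradient
outside the ball, where nothing controls it. -/
lemma exists_isLip_energyChainLip_le_of_bounded [Nonempty X]
    (hμ : ∀ s : Set X, Bornology.IsBounded s → μ s < ∞) (hp : 1 ≤ p) (hp' : p ≠ ∞) {u : X → ℝ}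
    (hu : MemLp u p μ) {M : ℝ≥0} (huM : ∀ x, |u x| ≤ M) {g : X → ℝ≥0∞} (hg : g ∈ UG u)
    {δ : ℝ≥0∞} (hδ : δ ≠ 0) (hδ' : δ ≠ ∞) :
    ∃ w, MemLp w p μ ∧ eLpNorm (w - u) p μ ≤ δ ∧ energyChainLip p μ w ≤ eLpNorm g p μ + δ := by
  obtain ⟨x₀⟩ := ‹Nonempty X›
  have hδ2 : 0 < δ / 2 := ENNReal.half_pos hδ
  have htail : Tendsto (fun n : ℕ => eLpNorm ((Metric.ball x₀ n)ᶜ.indicator u) p μ) atTop (𝓝 0) :=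
    tendsto_eLpNorm_zero_of_dominated hp hp' hu
      (fun n => hu.1.indicator Metric.isOpen_ball.measurableSet.compl)
      (fun n x => norm_indicator_le_norm_self u x) fun x => by
        refine tendsto_const_nhds.congr' ?_
        obtain ⟨n₀, hn₀⟩ := exists_nat_gt (dist x x₀)
        filter_upwards [eventually_ge_atTop n₀] with n hn
        have : x ∈ Metric.ball x₀ n := hn₀.trans_le (by exact_mod_cast hn)
        simp [this]
  have hsmall : Tendsto (fun n : ℕ => ‖(1 / (n : ℝ))‖ₑ * (eLpNorm u p μ + δ)) atTop (𝓝 0) := by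
    have h1 : Tendsto (fun n : ℕ => ‖(1 / (n : ℝ))‖ₑ) atTop (𝓝 0) := by
      simpa using (tendsto_one_div_atTop_nhds_zero_nat (𝕜 := ℝ)).enorm
    have h2 := ENNReal.Tendsto.mul_const (b := eLpNorm u p μ + δ) h1
      (Or.inr (ENNReal.add_ne_top.2 ⟨hu.2.ne, hδ'⟩))
    rwa [zero_mul] at h2
  obtain ⟨n, hn1, htailn, hsmalln⟩ := ((eventually_ge_atTop (1 : ℕ)).and
    ((htail.eventually (ge_mem_nhds hδ2)).and (hsmall.eventually (ge_mem_nhds hδ2)))).exists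
  set r : ℝ := (n : ℝ) with hr
  have hr1 : 1 ≤ r := by rw [hr]; exact_mod_cast hn1
  have hr0 : 0 < r := by linarith
  set b : Set X := Metric.ball x₀ (2 * r + 2) with hb
  have hbm : MeasurableSet b := Metric.isOpen_ball.measurableSet
  set ν := μ.restrict b with hν
  have : IsFiniteMeasure ν := ⟨by
    rw [hν, Measure.restrict_apply_univ]; exact hμ _ Metric.isBounded_ball⟩
  -- Adding `M` makes the function nonnegative, with values in `[0, 2M]`.
  have hg' : g ∈ UG fun x => u x + M := ⟨hg.1, fun γ s t hγ => by
    simpa only [add_sub_add_right_eq_sub] using hg.2 γ s t hγ⟩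
  obtain ⟨w₀, h, ε, B, hε, hw₀, hw₀M, ⟨Kh, hKh⟩, hB, hstep, hw₀u, hhg⟩ :=
    exists_approximation_of_isFiniteMeasure ν hp hp' (u := fun x => u x + M) (M := 2 * M)
      (fun x => by linarith [(abs_le.1 (huM x)).1])
      (fun x => by push_cast; linarith [(abs_le.1 (huM x)).2])
      (hu.1.mono_measure Measure.restrict_le_self |>.aemeasurable.add_const _) hg' hδ2.ne'
  set w₁ : X → ℝ := fun x => w₀ x - M with hw₁
  have hw₁M : ∀ x, |w₁ x| ≤ M := fun x => by
    have := hw₀M x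
    push_cast at this
    exact abs_le.2 ⟨by simp only [hw₁]; linarith [hw₀ x], by simp only [hw₁]; linarith⟩
  have hstep₁ : ∀ x y, dist x y ≤ ε → |w₁ y - w₁ x| ≤ ((h x : ℝ) + h y) / 2 * dist x y := by
    simpa only [hw₁, sub_sub_sub_cancel_right] using hstep
  have hw₁lip : IsLip w₁ := isLip_of_step hε hstep₁ hB hw₁M
  have hw₁c : Continuous w₁ := hw₁lip.choose_spec.continuous
  have hw₁u : eLpNorm (w₁ - u) p ν ≤ δ / 2 := by
    convert hw₀u using 2
    ext x
    simp [hw₁]; ring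
  have huν : eLpNorm u p ν ≤ eLpNorm u p μ := eLpNorm_mono_measure _ Measure.restrict_le_self
  have hw₁ν : eLpNorm w₁ p ν ≤ eLpNorm u p μ + δ := by
    have h1 := eLpNorm_add_le (μ := ν) (f := w₁ - u) (g := u)
      (hw₁c.aestronglyMeasurable.sub (hu.1.mono_measure Measure.restrict_le_self))
      (hu.1.mono_measure Measure.restrict_le_self) hp
    rw [sub_add_cancel] at h1
    rw [add_comm]
    exact h1.trans (add_le_add (hw₁u.trans ENNReal.half_le_self) huν)
  set ψ := cutoff x₀ (2 * r) r with hψ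
  set χ := cutoff x₀ (2 * r + 2) 1 with hχ
  set w : X → ℝ := fun x => ψ x * w₁ x with hw
  set f₀ : X → ℝ := fun x => (h x + |w₁ x| / r) * χ x with hf₀
  set f : X → ℝ≥0 := fun x => (f₀ x).toNNReal with hf
  have hf₀0 : ∀ x, 0 ≤ f₀ x := fun x => mul_nonneg (by positivity) (cutoff_nonneg _ _ _ _)
  have hff₀ : ∀ x, (f x : ℝ) = f₀ x := fun x => Real.coe_toNNReal _ (hf₀0 x)
  have hwlip : IsLip w := (isLip_cutoff x₀ _ hr0).mul hw₁lip (abs_cutoff_le_one _ _ _) hw₁M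
  have hflip : IsLip f := by
    have h1 : IsLip fun x => (h x : ℝ) + |w₁ x| / r := by
      obtain ⟨K₁, hK₁⟩ := hw₁lip
      refine isLip_of_abs_sub_le (K := Kh + K₁ / r) fun x y => ?_
      have e1 := hKh.dist_le_mul x y
      have e2 := hK₁.dist_le_mul x y
      rw [NNReal.dist_eq] at e1
      rw [Real.dist_eq] at e2
      have e3 : |(|w₁ x| - |w₁ y|) / r| ≤ K₁ * dist x y / r := by
        rw [abs_div, abs_of_pos hr0]
        gcongr
        exact (abs_abs_sub_abs_le_abs_sub _ _).trans e2
      calc |(h x : ℝ) + |w₁ x| / r - (h y + |w₁ y| / r)|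
          = |((h x : ℝ) - h y) + (|w₁ x| - |w₁ y|) / r| := by ring_nf
        _ ≤ _ := abs_add_le _ _
        _ ≤ Kh * dist x y + K₁ * dist x y / r := add_le_add e1 e3
        _ = _ := by ring
    obtain ⟨K, hK⟩ := h1.mul (isLip_cutoff x₀ (2 * r + 2) one_pos) (A := B + M / r) (B := 1)
      (fun x => by
        rw [abs_of_nonneg (by positivity)]
        have := hB x
        have := hw₁M x
        gcongr) (abs_cutoff_le_one _ _ _)
    exact ⟨1 * K, Real.lipschitzWith_toNNReal.comp hK⟩
  -- `w` vanishes beyond radius `2r` and `χ = 1` up to `2r + 1`, so a step of length at most `1`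
  -- that can change `w` stays where `χ = 1`.
  have hstepw : ∀ x y, dist x y ≤ min ε 1 → |w y - w x| ≤ ((f x : ℝ) + f y) / 2 * dist x y := by
    intro x y hxy
    rw [hff₀, hff₀]
    by_cases hfar : 2 * r ≤ dist x x₀ ∧ 2 * r ≤ dist y x₀
    · simp only [hw, hψ, cutoff_eq_zero hr0 hfar.1, cutoff_eq_zero hr0 hfar.2, zero_mul, sub_self,
        abs_zero]
      have := hf₀0 x
      have := hf₀0 y
      positivity
    · have hd1 := hxy.trans (min_le_right _ _)
      have ht1 := dist_triangle x y x₀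
      have ht2 := dist_triangle_left y x₀ x
      have hnear : dist x x₀ ≤ 2 * r + 2 - 1 ∧ dist y x₀ ≤ 2 * r + 2 - 1 := by
        rw [not_and_or, not_le, not_le] at hfar
        rcases hfar with h | h <;> constructor <;> linarith
      simp only [hf₀, hχ, cutoff_eq_one one_pos hnear.1, cutoff_eq_one one_pos hnear.2, mul_one]
      have e1 := hstep₁ x y (hxy.trans (min_le_left _ _))
      have e2 : |ψ y - ψ x| ≤ dist x y / r := by
        rw [dist_comm]
        exact abs_cutoff_sub_le x₀ _ hr0 y x
      have e3 : |(ψ x + ψ y) / 2| ≤ 1 := by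
        have a1 := cutoff_nonneg x₀ (2 * r) r x
        have a2 := cutoff_nonneg x₀ (2 * r) r y
        have a3 := cutoff_le_one x₀ (2 * r) r x
        have a4 := cutoff_le_one x₀ (2 * r) r y
        exact abs_le.2 ⟨by simp only [hψ]; linarith, by simp only [hψ]; linarith⟩
      have e4 : |(w₁ x + w₁ y) / 2| ≤ (|w₁ x| + |w₁ y|) / 2 := by
        rw [abs_div, abs_two]
        gcongr
        exact abs_add_le _ _
      -- The symmetric product rule reproduces exactly the trapezoidal averages of the chain
      -- integral.
      calc |w y - w x| = |(ψ x + ψ y) / 2 * (w₁ y - w₁ x) + (w₁ x + w₁ y) / 2 * (ψ y - ψ x)| := by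
            simp only [hw]; ring_nf
        _ ≤ |(ψ x + ψ y) / 2| * |w₁ y - w₁ x| + |(w₁ x + w₁ y) / 2| * |ψ y - ψ x| := by
            rw [← abs_mul, ← abs_mul]; exact abs_add_le _ _
        _ ≤ 1 * (((h x : ℝ) + h y) / 2 * dist x y) +
              (|w₁ x| + |w₁ y|) / 2 * (dist x y / r) :=
            add_le_add (mul_le_mul e3 e1 (abs_nonneg _) zero_le_one)
              (mul_le_mul e4 e2 (abs_nonneg _) (by positivity))
        _ = _ := by ring
  have hwu : eLpNorm (w - u) p μ ≤ δ := by
    have hsplit : ∀ x, ‖(w - u) x‖ ≤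
        ‖b.indicator (w₁ - u) x‖ + ‖(Metric.ball x₀ r)ᶜ.indicator u x‖ := by
      intro x
      rcases lt_or_ge (dist x x₀) r with hx | hx
      · have hψ1 : ψ x = 1 := cutoff_eq_one hr0 (by linarith)
        have hxb : x ∈ b := by rw [hb, Metric.mem_ball]; linarith
        have : (w - u) x = (w₁ - u) x := by simp [hw, hψ1]
        rw [this, indicator_of_mem hxb]
        exact le_add_of_nonneg_right (norm_nonneg _)
      · have hxr : x ∈ (Metric.ball x₀ r)ᶜ := by simpa using hx
        rw [indicator_of_mem hxr]
        have a1 := cutoff_nonneg x₀ (2 * r) r x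
        have a2 := cutoff_le_one x₀ (2 * r) r x
        rcases lt_or_ge (dist x x₀) (2 * r) with hx' | hx'
        · have hxb : x ∈ b := by rw [hb, Metric.mem_ball]; linarith
          rw [indicator_of_mem hxb]
          have : (w - u) x = ψ x * (w₁ - u) x + (ψ x - 1) * u x := by simp [hw]; ring
          rw [this]
          refine (norm_add_le _ _).trans (add_le_add ?_ ?_)
          · rw [norm_mul]
            exact mul_le_of_le_one_left (norm_nonneg _) (abs_cutoff_le_one _ _ _ _)
          · rw [norm_mul]
            refine mul_le_of_le_one_left (norm_nonneg _) (abs_le.2 ⟨?_, ?_⟩) <;>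
              simp only [hψ] <;> linarith
        · have hψ0 : ψ x = 0 := cutoff_eq_zero hr0 hx'
          have : (w - u) x = - u x := by simp [hw, hψ0]
          rw [this, norm_neg]
          exact le_add_of_nonneg_left (norm_nonneg _)
    have hm1 : AEStronglyMeasurable (b.indicator (w₁ - u)) μ :=
      (hw₁c.aestronglyMeasurable.sub hu.1).indicator hbm
    have hm2 : AEStronglyMeasurable ((Metric.ball x₀ r)ᶜ.indicator u) μ :=
      hu.1.indicator Metric.isOpen_ball.measurableSet.compl
    calc eLpNorm (w - u) p μ
        ≤ eLpNorm ((fun x => ‖b.indicator (w₁ - u) x‖) +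
            fun x => ‖(Metric.ball x₀ r)ᶜ.indicator u x‖) p μ := eLpNorm_mono_real hsplit
      _ ≤ _ := eLpNorm_add_le hm1.norm hm2.norm hp
      _ ≤ δ / 2 + δ / 2 := by
          rw [eLpNorm_norm, eLpNorm_norm, eLpNorm_indicator_eq_eLpNorm_restrict hbm]
          exact add_le_add hw₁u htailn
      _ = δ := ENNReal.add_halves δ
  have hwLp : MemLp w p μ := by
    have hwm : AEStronglyMeasurable w μ := hwlip.choose_spec.continuous.aestronglyMeasurable
    have : MemLp (w - u) p μ := ⟨hwm.sub hu.1, hwu.trans_lt hδ'.lt_top⟩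
    simpa using this.add hu
  refine ⟨w, hwLp, hwu, ?_⟩
  refine (energyChainLip_le_of_mem p μ hwlip (lt_min hε one_pos)
    (mem_chainLUG_of_step hflip hstepw)).trans ?_
  have hfle : ∀ x, ‖(f x : ℝ≥0∞)‖ₑ ≤
      ‖b.indicator ((fun x => (h x : ℝ≥0∞)) + fun x => ‖((1 / r) • w₁) x‖ₑ) x‖ₑ := by
    intro x
    rw [enorm_eq_self, enorm_eq_self]
    by_cases hx : x ∈ b
    · rw [indicator_of_mem hx, Pi.add_apply, Real.enorm_eq_ofReal_abs,
        ← ENNReal.ofReal_coe_nnreal (p := f x), hff₀, ← ENNReal.ofReal_coe_nnreal (p := h x),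
        ← ENNReal.ofReal_add (by positivity) (abs_nonneg _)]
      refine ENNReal.ofReal_le_ofReal ?_
      have e : |((1 / r) • w₁) x| = |w₁ x| / r := by
        rw [Pi.smul_apply, smul_eq_mul, abs_mul, abs_of_pos (by positivity)]; ring
      rw [e]
      exact mul_le_of_le_one_right (by positivity) (cutoff_le_one _ _ _ _)
    · have h0 : f₀ x = 0 := by
        have : 2 * r + 2 ≤ dist x x₀ := by simpa [hb] using hx
        simp only [hf₀, hχ, cutoff_eq_zero one_pos this, mul_zero]
      simp [hf, h0]
  calc eLpNorm (fun x => (f x : ℝ≥0∞)) p μ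
      ≤ eLpNorm ((fun x => (h x : ℝ≥0∞)) + fun x => ‖((1 / r) • w₁) x‖ₑ) p ν := by
        rw [hν, ← eLpNorm_indicator_eq_eLpNorm_restrict hbm]
        exact eLpNorm_mono_enorm hfle
    _ ≤ eLpNorm (fun x => (h x : ℝ≥0∞)) p ν + eLpNorm (fun x => ‖((1 / r) • w₁) x‖ₑ) p ν :=
        eLpNorm_add_le hKh.continuous.measurable.coe_nnreal_ennreal.aestronglyMeasurable
          (hw₁c.const_smul (1 / r)).enorm.measurable.aestronglyMeasurable hp
    _ ≤ (eLpNorm g p μ + δ / 2) + δ / 2 := by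
        refine add_le_add (hhg.trans ?_) ?_
        · gcongr
          exact Measure.restrict_le_self
        · rw [eLpNorm_enorm, eLpNorm_const_smul]
          exact (mul_le_mul_right hw₁ν _).trans hsmalln
    _ = eLpNorm g p μ + δ := by rw [add_assoc, ENNReal.add_halves]

/-- Truncation at height `n` is a contraction of `ℝ`, so it keeps the upper gradient `g`, and it
converges to `u` in `L^p`. -/
lemma exists_energyChainLip_le [Nonempty X] (hμ : ∀ s : Set X, Bornology.IsBounded s → μ s < ∞)
    (hp : 1 ≤ p) (hp' : p ≠ ∞) {u : X → ℝ} (hu : MemLp u p μ) {δ : ℝ≥0∞} (hδ : δ ≠ 0)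
    (hδ' : δ ≠ ∞) :
    ∃ w, MemLp w p μ ∧ eLpNorm (w - u) p μ ≤ δ ∧
      energyChainLip p μ w ≤ energyCurve p μ u + δ := by
  rcases eq_or_ne (energyCurve p μ u) ∞ with htop | htop
  · exact ⟨u, hu, by simp, by simp [htop]⟩
  have hδ2 : δ / 2 ≠ 0 := (ENNReal.half_pos hδ).ne'
  have hδ2' : δ / 2 ≠ ∞ := (ENNReal.half_le_self.trans_lt hδ'.lt_top).ne
  obtain ⟨g, hg, hgu⟩ : ∃ g ∈ UG u, eLpNorm g p μ < energyCurve p μ u + δ / 2 := by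
    have : energyCurve p μ u < energyCurve p μ u + δ / 2 := ENNReal.lt_add_right htop hδ2
    simpa only [energyCurve, iInf_lt_iff, exists_prop] using this
  set T : ℕ → X → ℝ := fun n x => max (-n) (min n (u x)) with hT
  have hTm : ∀ n, AEStronglyMeasurable (T n) μ := fun n =>
    (continuous_const.max (continuous_const.min continuous_id)).comp_aestronglyMeasurable hu.1
  have hTabs : ∀ n x, |T n x| ≤ n := fun n x => by
    have hn : (0 : ℝ) ≤ n := n.cast_nonneg
    exact abs_le.2 ⟨le_max_left _ _, max_le (by linarith) (min_le_left _ _)⟩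
  have hTlip : ∀ n x y, |T n x - T n y| ≤ |u x - u y| := fun n x y => by
    simp only [hT, max_comm (-(n : ℝ)), min_comm (n : ℝ)]
    refine (abs_max_sub_max_le_max _ _ _ _).trans ?_
    rw [sub_self, abs_zero, max_eq_left (abs_nonneg _)]
    refine (abs_min_sub_min_le_max _ _ _ _).trans ?_
    rw [sub_self, abs_zero, max_eq_left (abs_nonneg _)]
  have hTu : ∀ n x, |(T n - u) x| ≤ |u x| := fun n x => by
    have hn : (0 : ℝ) ≤ n := n.cast_nonneg
    simp only [hT, Pi.sub_apply]
    rcases max_cases (-(n : ℝ)) (min n (u x)) with ⟨h1, h2⟩ | ⟨h1, h2⟩ <;>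
    rcases min_cases (n : ℝ) (u x) with ⟨h3, h4⟩ | ⟨h3, h4⟩ <;>
    rcases abs_cases (u x) with ⟨h5, h6⟩ | ⟨h5, h6⟩ <;>
    rw [h1, h5, abs_le] <;> constructor <;> linarith
  have hTlim : Tendsto (fun n => eLpNorm (T n - u) p μ) atTop (𝓝 0) :=
    tendsto_eLpNorm_zero_of_dominated hp hp' hu (fun n => (hTm n).sub hu.1) hTu fun x => by
      refine tendsto_const_nhds.congr' ?_
      obtain ⟨n₀, hn₀⟩ := exists_nat_ge |u x|
      filter_upwards [eventually_ge_atTop n₀] with n hn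
      have hn' : |u x| ≤ n := hn₀.trans (by exact_mod_cast hn)
      have := abs_le.1 hn'
      simp only [hT, Pi.sub_apply]
      rw [min_eq_right this.2, max_eq_right this.1, sub_self]
  obtain ⟨n, hn⟩ := (hTlim.eventually (ge_mem_nhds (pos_iff_ne_zero.2 hδ2))).exists
  have hTLp : MemLp (T n) p μ := by
    have : MemLp (T n - u) p μ := ⟨(hTm n).sub hu.1, hn.trans_lt hδ2'.lt_top⟩
    simpa using this.add hu
  have hgT : g ∈ UG (T n) := ⟨hg.1, fun γ a b hγ =>
    (ENNReal.ofReal_le_ofReal (hTlip n _ _)).trans (hg.2 γ a b hγ)⟩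
  obtain ⟨w, hw, hwT, hwE⟩ := exists_isLip_energyChainLip_le_of_bounded hμ hp hp' hTLp
    (M := n) (by simpa using hTabs n) hgT hδ2 hδ2'
  refine ⟨w, hw, ?_, ?_⟩
  · have h1 := eLpNorm_add_le (f := w - T n) (g := T n - u) (hw.1.sub (hTm n))
      ((hTm n).sub hu.1) hp
    rw [sub_add_sub_cancel] at h1
    exact h1.trans ((add_le_add hwT hn).trans (ENNReal.add_halves δ).le)
  · refine hwE.trans ((add_le_add_left hgu.le _).trans ?_)
    rw [add_assoc, ENNReal.add_halves]

/-- Replace each member `v j` of a competing sequence by an approximation with error `1 / (j + 1)`: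
neither the `L^p` limit nor the bound on the liminf is affected. -/
lemma relaxation_energyChainLip_le [Nonempty X]
    (hμ : ∀ s : Set X, Bornology.IsBounded s → μ s < ∞) (hp : 1 ≤ p) (hp' : p ≠ ∞) {u : X → ℝ}
    (hu : AEStronglyMeasurable u μ) :
    relaxation p μ (energyChainLip p μ) u ≤ relaxation p μ (energyCurve p μ) u := by
  refine le_iInf fun v => le_iInf fun hv => le_iInf fun hvu => ?_
  set d : ℕ → ℝ≥0∞ := fun j => ((j : ℝ≥0∞) + 1)⁻¹ with hd
  have hdlim : Tendsto d atTop (𝓝 0) := by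
    have := (tendsto_add_atTop_iff_nat 1).2 ENNReal.tendsto_inv_nat_nhds_zero
    simpa [hd] using this
  choose w hw hwv hwE using fun j => exists_energyChainLip_le hμ hp hp' (hv j) (δ := d j)
    (by simp [hd]) (by simp [hd])
  have hwu : Tendsto (fun j => eLpNorm (w j - u) p μ) atTop (𝓝 0) := by
    have hsum := hdlim.add hvu
    rw [add_zero] at hsum
    refine tendsto_of_tendsto_of_tendsto_of_le_of_le tendsto_const_nhds hsum (fun _ => zero_le)
      fun j => ?_
    have h1 := eLpNorm_add_le (f := w j - v j) (g := v j - u) ((hw j).1.sub (hv j).1)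
      ((hv j).1.sub hu) hp
    rw [sub_add_sub_cancel] at h1
    exact h1.trans (add_le_add_left (hwv j) _)
  refine iInf_le_of_le w (iInf_le_of_le hw (iInf_le_of_le hwu ?_))
  rw [← ENNReal.liminf_add_of_right_tendsto_zero hdlim fun j => energyCurve p μ (v j)]
  exact liminf_le_liminf (Eventually.of_forall hwE)

end Density

end ChainSobolev

/-! ### The main theorem. -/

theorem mainTheorem3 {X : Type*} [MetricSpace X] [CompleteSpace X]
    [TopologicalSpace.SeparableSpace X] [MeasurableSpace X] [BorelSpace X]
    (μ : Measure X) (hμ_ne : μ ≠ 0)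
    (hμ_fin : ∀ s : Set X, Bornology.IsBounded s → μ s < ∞)
    (p : ℝ≥0∞) (hp_one : 1 ≤ p) (hp_top : p ≠ ∞) :
    ChainSobolev.sobolevSpace p μ (ChainSobolev.energyChainLip p μ) =
        ChainSobolev.sobolevSpace p μ (ChainSobolev.energyCurve p μ) ∧
      (∀ u : Lp ℝ p μ,
        ChainSobolev.sobolevNorm p μ (ChainSobolev.energyChainLip p μ) u =
          ChainSobolev.sobolevNorm p μ (ChainSobolev.energyCurve p μ) u) ∧
      ∀ u : Lp ℝ p μ,
        ChainSobolev.relaxation p μ (ChainSobolev.energyChainLip p μ) u =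
          ChainSobolev.relaxation p μ (ChainSobolev.energyCurve p μ) u := by
  have : SecondCountableTopology X := UniformSpace.secondCountable_of_separable X
  -- A point is needed as the centre of the cutoffs.
  have : Nonempty X := by
    by_contra h
    rw [not_nonempty_iff] at h
    exact hμ_ne (Measure.eq_zero_of_isEmpty μ)
  have key : ∀ u : Lp ℝ p μ,
      ChainSobolev.relaxation p μ (ChainSobolev.energyChainLip p μ) u =
        ChainSobolev.relaxation p μ (ChainSobolev.energyCurve p μ) u := fun u =>
    le_antisymm
      (ChainSobolev.relaxation_energyChainLip_le hμ_fin hp_one hp_top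
        (Lp.aestronglyMeasurable u))
      (ChainSobolev.relaxation_mono (ChainSobolev.energyCurve_le_energyChainLip p μ) u)
  refine ⟨?_, fun u => ?_, key⟩
  · ext u
    simp only [ChainSobolev.sobolevSpace, mem_ofPred_eq, key]
  · rw [ChainSobolev.sobolevNorm, ChainSobolev.sobolevNorm, key]
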